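/- A virtual curve diagram (vcd) with $n$ curves is, up to renaming of points, a finite set of points $P=B\sqcup U$ with two strict partial orders. The order $<_P$ is the disjoint union of the two chains $B$ ($n$ base points) and $U$ (upper points). The order $<_C$ is the disjoint union of $n$ chains, the curves; each consists of one base point, which is its least element, and at least one upper point. The largest point of a curve is called terminal. An arc $(a,b)$ is a pair of consecutive points $a<_C b$ of a curve; the first arc of a curve is its base arc, and after it over and under arcs alternate, beginning with an over arc. An arc encloses the points that lie strictly between its endpoints in $<_P$, and it encloses the arcs both of whose endpoints it encloses. Two over arcs, or two under arcs, cross if their endpoints interleave in $<_P$; an under arc and a base arc cross if the under arc encloses the upper endpoint of the base arc; two base arcs cross if their base points and their upper endpoints are ordered oppositely; no other arcs cross. In a vcd no two over arcs cross. Two upper points are adjacent if they are consecutive in $<_P$. Simplifying $T$- and $B$-moves: let $(a,b)$ be an over or under arc with $a$ and $b$ adjacent. If $b$ is terminal, the simplifying $T$-move deletes $b$; otherwise the simplifying $B$-move deletes $a$ and $b$. A vcd is simplified if it admits no simplifying $T$- or $B$-move. Two over arcs or two under arcs are parallel if they do not cross and each endpoint of the first is adjacent to the corresponding endpoint of the second,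 for one of the two ways of matching endpoints. Condensed arcs are the classes of the reflexive transitive closure of this relation (so a base arc is a class by itself). A condensed over or under arc $A$ of weight $r=|A|$ consists of nested arcs $\{a_1,b_1\},\dots,\{a_r,b_r\}$ with $a_1<_P\dots<_P a_r<_P b_r<_P\dots<_P b_1$. The corners of $A$ are $a_1,a_r,b_r,b_1$; the corners of a base arc are its two endpoints. The condensed vcd $D\in\mathrm{cVCD}_n$ with underlying vcd $E$ with $n$ curves records the terminal points of $E$, the corners, weight and type (over, under or base) of every condensed arc, and the restriction of $<_P$ to terminal points and corners. $D$ is called simplified if $E$ is. Simplifying condensed moves: let $A$ be a condensed over or under arc of weight $r$ with $a_r$ and $b_r$ adjacent. If one of $a_r,b_r$ is terminal, the simplifying condensed $T$-move deletes it. If neither is terminal, the simplifying condensed $B$-move deletes all points of $A$ when no point of $A$ is terminal, and otherwise deletes all $a_j,b_j$ with $i<j\le r$, where $i<r$ is the largest index such that $a_i$ or $b_i$ is terminal. In each case the result is the condensed vcd of the resulting vcd. Condensed $T$- and $B$-moves are these moves and their inverses. An under arc is free if it crosses no under or base arc and encloses no two crossing under arcs; a base arc is free if it crosses no under or base arc;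 a condensed under or base arc is free if all its arcs are free. Lemma. (a) A condensed vcd is simplified if and only if it admits no simplifying condensed $T$- or $B$-move. (b) If $D_1$ and $D_2$ are simplified condensed vcds with $n$ curves that are related by a finite sequence of condensed $T$- and $B$-moves, then $D_1=D_2$. (c) If $n\ge 1$ and $D\in\mathrm{cVCD}_n$ is simplified, then $D$ has at most $2n-1$ condensed over arcs, at most $2n-1$ free condensed under arcs and at most $n$ free condensed base arcs. -/

import Mathlib

/-- The three kinds of arcs. -/
inductive ArcKind where
  | over
  | under
  | base

/-- The points and curves of a diagram with `n` curves, without the condition on over arcs.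
The point set is `P = B ⊔ U`, where `B = Fin n` is the chain of base points and
`U = Fin numUpper` is the chain of upper points; `<_P` is the disjoint union of these two chains,
which is the order `<` that the type `Fin n ⊕ Fin numUpper` carries.
The order `<_C` is the disjoint union of `n` chains, the curves: the `i`-th curve starts at the
base point `i` and then runs through the upper points in the nonempty list `curve i`.
Every triple `(P, <_P, <_C)` of this kind is isomorphic to exactly one such normal form, so
equality of normal forms is equality of diagrams (up to renaming points). -/
structure CurveSystem (n : ℕ) where
  numUpper : ℕ
  curve : Fin n → List (Fin numUpper)
  curve_ne_nil : ∀ i, curve i ≠ []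
  curve_nodup : ∀ i, (curve i).Nodup
  existsUnique_curve : ∀ p : Fin numUpper, ∃! i, p ∈ curve i

namespace CurveSystem

variable {n : ℕ}

/-- The set `P` of points; `Sum.inl` gives the base points and `Sum.inr` the upper points. -/
abbrev Point (E : CurveSystem n) : Type := Fin n ⊕ Fin E.numUpper

/-- All points of the `i`-th curve, in the order `<_C`. -/
def path (E : CurveSystem n) (i : Fin n) : List E.Point :=
  Sum.inl i :: (E.curve i).map Sum.inr

/-- A terminal point is the `<_C`-largest point of a curve. -/
def IsTerminal (E : CurveSystem n) (p : E.Point) : Prop :=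
  ∃ i, p = Sum.inr ((E.curve i).getLast (E.curve_ne_nil i))

/-- An arc joins two consecutive points of a curve: the arc `⟨i, k⟩` joins the `k`-th
and the `(k + 1)`-st point of the `i`-th curve, counted from `0`. -/
abbrev Arc (E : CurveSystem n) : Type := Σ i : Fin n, Fin (E.curve i).length

variable {E : CurveSystem n}

/-- The `<_C`-smaller endpoint `a` of an arc `(a, b)`. -/
def Arc.src (α : E.Arc) : E.Point :=
  (E.path α.1)[α.2.val]'(by have := α.2.isLt; simp only [path, List.length_cons, List.length_map]; omega)

/-- The `<_C`-larger endpoint `b` of an arc `(a, b)`. -/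
def Arc.tgt (α : E.Arc) : E.Point :=
  (E.path α.1)[α.2.val + 1]'(by have := α.2.isLt; simp only [path, List.length_cons, List.length_map]; omega)

/-- The first arc of a curve is its base arc; after it, over and under arcs alternate,
beginning with an over arc. -/
def Arc.kind (α : E.Arc) : ArcKind :=
  if α.2.val = 0 then ArcKind.base
  else if α.2.val % 2 = 1 then ArcKind.over
  else ArcKind.under

def Arc.IsOver (α : E.Arc) : Prop := α.kind = ArcKind.over

def Arc.IsUnder (α : E.Arc) : Prop := α.kind = ArcKind.under

def Arc.IsBase (α : E.Arc) : Prop := α.kind = ArcKind.base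

/-- The point `p` is incident to the arc `α`. -/
def Arc.Incident (α : E.Arc) (p : E.Point) : Prop := p = α.src ∨ p = α.tgt

/-- The arc `α` encloses the point `p`: it lies strictly between the endpoints of `α`. -/
def Arc.EnclosesPoint (α : E.Arc) (p : E.Point) : Prop :=
  (α.src < p ∧ p < α.tgt) ∨ (α.tgt < p ∧ p < α.src)

/-- The arc `α` encloses both endpoints of the arc `β`. -/
def Arc.EnclosesArc (α β : E.Arc) : Prop :=
  α.EnclosesPoint β.src ∧ α.EnclosesPoint β.tgt

/-- Crossing arcs. Over arcs are drawn above the line of upper points, under and base arcs in the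
strip between that line and the line of base points. Two over arcs, or two under arcs, cross when
their endpoints interleave; an under arc and a base arc cross when the under arc encloses the upper
endpoint of the base arc; two base arcs cross when their upper endpoints and their base points are
ordered oppositely. -/
def Arc.Cross (α β : E.Arc) : Prop :=
  match α.kind, β.kind with
  | ArcKind.over, ArcKind.over => Xor (α.EnclosesPoint β.src) (α.EnclosesPoint β.tgt)
  | ArcKind.under, ArcKind.under => Xor (α.EnclosesPoint β.src) (α.EnclosesPoint β.tgt)
  | ArcKind.under, ArcKind.base => α.EnclosesPoint β.tgt
  | ArcKind.base, ArcKind.under => β.EnclosesPoint α.tgt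
  | ArcKind.base, ArcKind.base =>
      (α.src < β.src ∧ β.tgt < α.tgt) ∨ (β.src < α.src ∧ α.tgt < β.tgt)
  | _, _ => False

/-- Two points are adjacent if one covers the other in `<_P`. -/
def Adjacent (p q : E.Point) : Prop := p ⋖ q ∨ q ⋖ p

/-- The elementary parallelity relation between two over arcs or two under arcs. -/
def Arc.ParallelStep (α β : E.Arc) : Prop :=
  ((α.IsOver ∧ β.IsOver) ∨ (α.IsUnder ∧ β.IsUnder)) ∧
  ((Adjacent α.src β.src ∧ Adjacent α.tgt β.tgt) ∨
    (Adjacent α.src β.tgt ∧ Adjacent α.tgt β.src)) ∧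
  ¬ α.Cross β

/-- Parallelity: the reflexive transitive closure. A base arc is parallel only to itself. -/
def Arc.Parallel (α β : E.Arc) : Prop :=
  Relation.ReflTransGen Arc.ParallelStep α β

/-- An under arc is free if it crosses no under or base arc and encloses no pair of crossing
under arcs. -/
def Arc.IsFreeUnder (α : E.Arc) : Prop :=
  α.IsUnder ∧ (∀ β : E.Arc, β.IsUnder ∨ β.IsBase → ¬ α.Cross β) ∧
  ¬ ∃ β γ : E.Arc, β.IsUnder ∧ γ.IsUnder ∧ β.Cross γ ∧ α.EnclosesArc β ∧ α.EnclosesArc γ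

/-- A base arc is free if it crosses no under or base arc. -/
def Arc.IsFreeBase (α : E.Arc) : Prop :=
  α.IsBase ∧ ∀ β : E.Arc, β.IsUnder ∨ β.IsBase → ¬ α.Cross β

/-- The set of condensed arcs, that is, of parallelity classes of arcs. -/
def condensedArcs (E : CurveSystem n) : Set (Set E.Arc) :=
  Set.range fun α : E.Arc => {β | α.Parallel β}

/-- The points incident to a condensed arc. -/
def incidentPoints (A : Set E.Arc) : Set E.Point := {p | ∃ α ∈ A, α.Incident p}

/-- `α` is the arc `{a_1, b_1}` of `A`. -/
def IsOutermost (A : Set E.Arc) (α : E.Arc) : Prop :=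
  α ∈ A ∧ ∀ β ∈ A, β ≠ α → α.EnclosesArc β

/-- `α` is the arc `{a_r, b_r}` of `A`. -/
def IsInnermost (A : Set E.Arc) (α : E.Arc) : Prop :=
  α ∈ A ∧ ∀ β ∈ A, β ≠ α → β.EnclosesArc α

/-- The corners of a condensed arc: the endpoints of its outermost and its innermost arc. -/
def corners (A : Set E.Arc) : Set E.Point :=
  {p | ∃ α, (IsOutermost A α ∨ IsInnermost A α) ∧ α.Incident p}

/-- The weight of a condensed arc: the number of its arcs. -/
noncomputable def weight (A : Set E.Arc) : ℕ := A.ncard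

/-- `P⌝`: the terminal points and all the corners. -/
def cornerPoints (E : CurveSystem n) : Set E.Point :=
  {p | E.IsTerminal p} ∪ ⋃ A ∈ E.condensedArcs, corners A

end CurveSystem

open CurveSystem

/-- Virtual curve diagrams with `n` curves: no two over arcs cross. -/
structure VCD (n : ℕ) extends CurveSystem n where
  over_not_cross : ∀ α β : toCurveSystem.Arc, α.IsOver → β.IsOver → ¬ α.Cross β

namespace VCD

variable {n : ℕ}

open Classical in
/-- `E'` is (up to renaming points) obtained from `E` by deleting the upper points in `S`. -/
def IsDeletion (E E' : VCD n) (S : Set E.Point) : Prop :=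
  ∃ f : Fin E'.numUpper ↪o Fin E.numUpper,
    (∀ p : Fin E.numUpper, p ∈ Set.range f ↔ Sum.inr p ∉ S) ∧
    ∀ i, (E'.curve i).map f = (E.curve i).filter fun p => decide (Sum.inr p ∉ S)

/-- Simplifying `T`-move along an over or under arc `(a, b)` with `a`, `b` adjacent and `b`
terminal: `b` is deleted. -/
def SimplifyingT (E E' : VCD n) : Prop :=
  ∃ α : E.Arc, (α.IsOver ∨ α.IsUnder) ∧ Adjacent α.src α.tgt ∧ E.IsTerminal α.tgt ∧
    IsDeletion E E' {α.tgt}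

/-- Simplifying `B`-move along an over or under arc `(a, b)` with `a`, `b` adjacent and `b`
not terminal: `a` and `b` are deleted. -/
def SimplifyingB (E E' : VCD n) : Prop :=
  ∃ α : E.Arc, (α.IsOver ∨ α.IsUnder) ∧ Adjacent α.src α.tgt ∧ ¬ E.IsTerminal α.tgt ∧
    IsDeletion E E' {α.src, α.tgt}

/-- A diagram is simplified if it admits no simplifying `T`- or `B`-move. -/
def Simplified (E : VCD n) : Prop :=
  ¬ ∃ E' : VCD n, E.SimplifyingT E' ∨ E.SimplifyingB E'

end VCD

/-- The tuple that records a condensed diagram whose points come from `P`: the set `T` of terminal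
points, the triples of corner set, weight and type of the condensed arcs, and the restriction
of the order to terminal points and corners. -/
structure CondensedTuple (P : Type) where
  terminal : Set P
  arcs : Set (Set P × ℕ × ArcKind)
  lt : P → P → Prop

/-- The tuple of a diagram. -/
noncomputable def VCD.condense {n : ℕ} (E : VCD n) : CondensedTuple E.Point where
  terminal := {p | E.IsTerminal p}
  arcs := {x | ∃ A ∈ E.condensedArcs, ∃ α ∈ A, x = (corners A, weight A, α.kind)}
  lt p q := p ∈ E.cornerPoints ∧ q ∈ E.cornerPoints ∧ p < q

/-- Condensed virtual curve diagrams with `n` curves: a tuple together with the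
underlying virtual curve diagram that it comes from. -/
structure CVCD (n : ℕ) where
  underlying : VCD n
  tuple : CondensedTuple underlying.Point
  tuple_eq : tuple = underlying.condense

namespace CVCD

variable {n : ℕ}

/-- A condensed diagram is simplified if its underlying diagram is. -/
def Simplified (D : CVCD n) : Prop := D.underlying.Simplified

/-- Condensed over or under arcs. -/
def IsOverOrUnder {E : VCD n} (A : Set E.Arc) : Prop :=
  (∀ α ∈ A, α.IsOver) ∨ ∀ α ∈ A, α.IsUnder

/-- Simplifying condensed `T`-move along a condensed over or under arc `A` whose innermost
points `a_r`, `b_r` are adjacent, one of them being terminal: this terminal point is deleted. -/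
def SimplifyingCondensedT (D D' : CVCD n) : Prop :=
  ∃ A ∈ D.underlying.condensedArcs, IsOverOrUnder A ∧
    ∃ α, IsInnermost A α ∧ Adjacent α.src α.tgt ∧
      ∃ p, α.Incident p ∧ D.underlying.IsTerminal p ∧
        VCD.IsDeletion D.underlying D'.underlying {p}

/-- Simplifying condensed `B`-move along a condensed over or under arc `A` whose innermost
points `a_r`, `b_r` are adjacent and not terminal. If no point of `A` is terminal, then all points
of `A` are deleted. Otherwise let `β = {a_i, b_i}` be the innermost arc of `A` that has a terminal
endpoint: the points `a_j`, `b_j` with `i < j ≤ r`, that is, the endpoints of the arcs of `A` inside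
`β`, are deleted. -/
def SimplifyingCondensedB (D D' : CVCD n) : Prop :=
  ∃ A ∈ D.underlying.condensedArcs, IsOverOrUnder A ∧
    ∃ α, IsInnermost A α ∧ Adjacent α.src α.tgt ∧
      ¬ D.underlying.IsTerminal α.src ∧ ¬ D.underlying.IsTerminal α.tgt ∧
      (((∀ p ∈ incidentPoints A, ¬ D.underlying.IsTerminal p) ∧
          VCD.IsDeletion D.underlying D'.underlying (incidentPoints A)) ∨
        ∃ β, IsInnermost {γ ∈ A | ∃ p, γ.Incident p ∧ D.underlying.IsTerminal p} β ∧
          VCD.IsDeletion D.underlying D'.underlying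
            (incidentPoints {γ ∈ A | β.EnclosesArc γ}))

/-- A simplifying condensed `T`- or `B`-move from `D` to `D'`. -/
def SimplifyingMove (D D' : CVCD n) : Prop :=
  D.SimplifyingCondensedT D' ∨ D.SimplifyingCondensedB D'

/-- Being related by a finite sequence of condensed `T`- and `B`-moves: simplifying moves
and their inverses. -/
def Related : CVCD n → CVCD n → Prop := Relation.EqvGen SimplifyingMove

def condensedOverArcs (D : CVCD n) : Set (Set D.underlying.Arc) :=
  {A ∈ D.underlying.condensedArcs | ∀ α ∈ A, α.IsOver}

def freeCondensedUnderArcs (D : CVCD n) : Set (Set D.underlying.Arc) :=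
  {A ∈ D.underlying.condensedArcs | ∀ α ∈ A, α.IsFreeUnder}

def freeCondensedBaseArcs (D : CVCD n) : Set (Set D.underlying.Arc) :=
  {A ∈ D.underlying.condensedArcs | ∀ α ∈ A, α.IsFreeBase}

end CVCD

/-! Condensed moves reduce to uncondensed ones. A simplifying move is described by a pair `p`, `q`
that is consecutive on a curve and adjacent in the chain of upper points: it deletes `q`, and also
`p` unless `q` is terminal. The result is always a diagram (`exists_deletes_moveSet`), so a diagram
is simplified exactly when no such pair exists.

An arc with adjacent endpoints is innermost in its class, and the class is a nest around it
(`Arc.Parallel.exists_atLevel`). Removing arcs from the inside outwards turns a condensed B-move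
into a sequence of simplifying moves (`exists_delete_nest`). These are confluent (`Move.diamond`):
moves along disjoint pairs commute, and moves along `p, q` and `q, r` agree up to one further
T-move, because the surviving `p` or `r` takes the same place. Related simplified diagrams have a
common reduct, which equals both; termination plays no role.

For the bounds, send an over arc, or a free under arc, to the set of curves whose terminal points it
encloses. In a simplified diagram these sets are nonempty and laminar, and arcs with the same set
are parallel. So the condensed arcs inject into a laminar family of nonempty subsets of an
`n`-element set, which has at most `2n - 1` members. Both families of arcs are handled at once by
`IsPlanar`. Base arcs are counted by their curves. -/

namespace CurveSystem

/-! ### Positions on curves and consecutive upper points -/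

variable {n : ℕ}

/-- The upper point `p` is the `j`-th entry of the `i`-th curve. -/
def At (E : CurveSystem n) (i : Fin n) (j : ℕ) (p : Fin E.numUpper) : Prop :=
  (E.curve i)[j]? = some p

/-- The upper point `q` follows the upper point `p` on a curve. -/
def Next (E : CurveSystem n) (p q : Fin E.numUpper) : Prop :=
  ∃ i j, E.At i j p ∧ E.At i (j + 1) q

/-- The upper point `q` follows the upper point `p` on a curve, along an over arc if `k = 0` and
along an under arc if `k = 1`. -/
def Step (E : CurveSystem n) (k : ℕ) (p q : Fin E.numUpper) : Prop :=
  ∃ i j, E.At i j p ∧ E.At i (j + 1) q ∧ j % 2 = k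

/-- The upper point `p` is terminal. -/
def Term (E : CurveSystem n) (p : Fin E.numUpper) : Prop := E.IsTerminal (Sum.inr p)

/-- Two upper points are neighbours in the chain of upper points. -/
def Adj {N : ℕ} (p q : Fin N) : Prop := p.val + 1 = q.val ∨ q.val + 1 = p.val

/-- The number `x` lies strictly between `a` and `b`. -/
def Btw (a b x : ℕ) : Prop := (a < x ∧ x < b) ∨ (b < x ∧ x < a)

variable {E : CurveSystem n}

theorem exists_at (p : Fin E.numUpper) : ∃ i j, E.At i j p := by
  obtain ⟨i, hi, -⟩ := E.existsUnique_curve p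
  obtain ⟨j, hj⟩ := List.getElem?_of_mem hi
  exact ⟨i, j, hj⟩

theorem At.mem {i : Fin n} {j : ℕ} {p : Fin E.numUpper} (h : E.At i j p) : p ∈ E.curve i :=
  List.mem_of_getElem? h

theorem At.unique {i i' : Fin n} {j j' : ℕ} {p : Fin E.numUpper}
    (h : E.At i j p) (h' : E.At i' j' p) : i = i' ∧ j = j' := by
  obtain rfl : i = i' := (E.existsUnique_curve p).unique h.mem h'.mem
  refine ⟨rfl, ?_⟩
  unfold At at h h'
  have hj : j < (E.curve i).length := (List.getElem?_eq_some_iff.1 h).1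
  exact (List.getElem?_inj hj (E.curve_nodup i)).1 (h.trans h'.symm)

theorem At.point_eq {i : Fin n} {j : ℕ} {p q : Fin E.numUpper}
    (h : E.At i j p) (h' : E.At i j q) : p = q :=
  Option.some.inj (h.symm.trans h')

theorem At.of_le {i : Fin n} {j j' : ℕ} {p : Fin E.numUpper} (h : E.At i j p) (hj : j' ≤ j) :
    ∃ q, E.At i j' q := by
  have hl : j < (E.curve i).length := (List.getElem?_eq_some_iff.1 h).1
  exact ⟨(E.curve i)[j'], List.getElem?_eq_getElem (by omega)⟩

theorem term_iff {p : Fin E.numUpper} :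
    E.Term p ↔ ∃ i j, E.At i j p ∧ ∀ q, ¬ E.At i (j + 1) q := by
  have hlast : ∀ i, E.At i ((E.curve i).length - 1) ((E.curve i).getLast (E.curve_ne_nil i)) := by
    intro i
    have := List.length_pos_iff.2 (E.curve_ne_nil i)
    rw [At, List.getLast_eq_getElem, List.getElem?_eq_getElem (by omega)]
  constructor
  · rintro ⟨i, hi⟩
    obtain rfl := Sum.inr.inj hi
    have := List.length_pos_iff.2 (E.curve_ne_nil i)
    refine ⟨i, _, hlast i, fun q hq => ?_⟩
    have : (E.curve i).length - 1 + 1 < (E.curve i).length := (List.getElem?_eq_some_iff.1 hq).1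
    omega
  · rintro ⟨i, j, hj, hn⟩
    have hl : j < (E.curve i).length := (List.getElem?_eq_some_iff.1 hj).1
    have : j = (E.curve i).length - 1 := by
      by_contra hne
      exact hn _ (List.getElem?_eq_getElem (by omega : j + 1 < (E.curve i).length))
    subst this
    exact ⟨i, congrArg Sum.inr (hj.point_eq (hlast i))⟩

theorem Step.next {k : ℕ} {p q : Fin E.numUpper} (h : E.Step k p q) : E.Next p q := by
  obtain ⟨i, j, h1, h2, -⟩ := h
  exact ⟨i, j, h1, h2⟩

theorem Next.exists_step {p q : Fin E.numUpper} (h : E.Next p q) : ∃ k < 2, E.Step k p q := by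
  obtain ⟨i, j, h1, h2⟩ := h
  exact ⟨j % 2, Nat.mod_lt _ (by omega), i, j, h1, h2, rfl⟩

theorem Next.not_term {p q : Fin E.numUpper} (h : E.Next p q) : ¬ E.Term p := by
  rw [term_iff]
  rintro ⟨i, j, h1, h2⟩
  obtain ⟨i', j', h3, h4⟩ := h
  obtain ⟨rfl, rfl⟩ := h1.unique h3
  exact h2 _ h4

theorem Next.right_unique {p q r : Fin E.numUpper} (h : E.Next p q) (h' : E.Next p r) :
    q = r := by
  obtain ⟨i, j, h1, h2⟩ := h
  obtain ⟨i', j', h3, h4⟩ := h'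
  obtain ⟨rfl, rfl⟩ := h1.unique h3
  exact h2.point_eq h4

theorem Next.left_unique {p q r : Fin E.numUpper} (h : E.Next p r) (h' : E.Next q r) :
    p = q := by
  obtain ⟨i, j, h1, h2⟩ := h
  obtain ⟨i', j', h3, h4⟩ := h'
  obtain ⟨rfl, hj⟩ := h2.unique h4
  obtain rfl : j = j' := by omega
  exact h1.point_eq h3

theorem Next.ne {p q : Fin E.numUpper} (h : E.Next p q) : p ≠ q := by
  rintro rfl
  obtain ⟨i, j, h1, h2⟩ := h
  have := (h1.unique h2).2
  omega

theorem not_term_iff {p : Fin E.numUpper} : ¬ E.Term p ↔ ∃ q, E.Next p q := by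
  constructor
  · intro h
    by_contra hn
    obtain ⟨i, j, hj⟩ := exists_at p
    exact h (term_iff.2 ⟨i, j, hj, fun q hq => hn ⟨q, i, j, hj, hq⟩⟩)
  · rintro ⟨q, hq⟩
    exact hq.not_term

theorem Next.irrefl_two {p q : Fin E.numUpper} (h : E.Next p q) (h' : E.Next q p) : False := by
  obtain ⟨i, j, h1, h2⟩ := h
  obtain ⟨i', j', h3, h4⟩ := h'
  have := h1.unique h4
  have := h2.unique h3
  omega

/-- Over and under arcs alternate: the parity of the index changes at each step. -/
theorem Step.not_consecutive {k : ℕ} {p q r : Fin E.numUpper} (h : E.Step k p q)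
    (h' : E.Step k q r) : False := by
  obtain ⟨i, j, h1, h2, h5⟩ := h
  obtain ⟨i', j', h3, h4, h6⟩ := h'
  have := (h2.unique h3).2
  omega

/-! ### Arcs and pairs of consecutive upper points -/

/-- The arc `α` is an over arc (`k = 0`) or an under arc (`k = 1`) from `p` to `q`. -/
structure Arc.Joins (α : E.Arc) (k : ℕ) (p q : Fin E.numUpper) : Prop where
  src_eq : α.src = Sum.inr p
  tgt_eq : α.tgt = Sum.inr q
  ne_zero : α.2.val ≠ 0
  parity : (α.2.val - 1) % 2 = k
  at_src : E.At α.1 (α.2.val - 1) p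
  at_tgt : E.At α.1 α.2.val q

theorem Arc.exists_joins {α : E.Arc} (h : α.2.val ≠ 0) :
    ∃ p q, α.Joins ((α.2.val - 1) % 2) p q := by
  obtain ⟨i, j, hj⟩ := α
  obtain _ | j := j
  · exact absurd rfl h
  · refine ⟨(E.curve i)[j], (E.curve i)[j + 1], ?_, ?_, h, rfl, ?_, ?_⟩
    · simp [Arc.src, path]
    · simp [Arc.tgt, path]
    · simp [At]
    · simp [At, hj]

theorem Step.exists_joins {k : ℕ} {p q : Fin E.numUpper} (h : E.Step k p q) :
    ∃ α : E.Arc, α.Joins k p q := by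
  obtain ⟨i, j, h1, h2, h3⟩ := h
  have hl : j + 1 < (E.curve i).length := (List.getElem?_eq_some_iff.1 h2).1
  obtain ⟨p', q', h⟩ := Arc.exists_joins (α := (⟨i, ⟨j + 1, hl⟩⟩ : E.Arc)) (by simp)
  have hp := h.at_src.point_eq h1
  have hq := h.at_tgt.point_eq h2
  subst hp hq
  refine ⟨⟨i, ⟨j + 1, hl⟩⟩, ?_⟩
  rw [← h3]
  exact h

theorem Arc.Joins.step {α : E.Arc} {k : ℕ} {p q : Fin E.numUpper} (h : α.Joins k p q) :
    E.Step k p q := by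
  have := h.ne_zero
  refine ⟨α.1, α.2.val - 1, h.at_src, ?_, h.parity⟩
  rw [Nat.sub_add_cancel (by omega)]
  exact h.at_tgt

theorem Arc.ext_of {α β : E.Arc} (h1 : α.1 = β.1) (h2 : α.2.val = β.2.val) : α = β := by
  obtain ⟨i, j⟩ := α
  obtain ⟨i', j'⟩ := β
  dsimp only at h1
  subst h1
  congr 1
  exact Fin.ext h2

theorem Arc.Joins.eq_of_tgt {α β : E.Arc} {k k' : ℕ} {p q p' : Fin E.numUpper}
    (h : α.Joins k p q) (h' : β.Joins k' p' q) : α = β :=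
  Arc.ext_of (h.at_tgt.unique h'.at_tgt).1 (h.at_tgt.unique h'.at_tgt).2

theorem Arc.isOver_iff {α : E.Arc} : α.IsOver ↔ ∃ p q, α.Joins 0 p q := by
  unfold Arc.IsOver Arc.kind
  constructor
  · intro h
    split_ifs at h with h1 h2
    obtain ⟨p, q, h3⟩ := Arc.exists_joins h1
    rw [show (α.2.val - 1) % 2 = 0 by omega] at h3
    exact ⟨p, q, h3⟩
  · rintro ⟨p, q, h⟩
    have := h.ne_zero
    have := h.parity
    rw [if_neg (by omega), if_pos (by omega)]

theorem Arc.isUnder_iff {α : E.Arc} : α.IsUnder ↔ ∃ p q, α.Joins 1 p q := by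
  unfold Arc.IsUnder Arc.kind
  constructor
  · intro h
    split_ifs at h with h1 h2
    obtain ⟨p, q, h3⟩ := Arc.exists_joins h1
    rw [show (α.2.val - 1) % 2 = 1 by omega] at h3
    exact ⟨p, q, h3⟩
  · rintro ⟨p, q, h⟩
    have := h.ne_zero
    have := h.parity
    rw [if_neg (by omega), if_neg (by omega)]

theorem Arc.Joins.lt_two {α : E.Arc} {k : ℕ} {p q : Fin E.numUpper} (h : α.Joins k p q) :
    k < 2 := by
  have := h.parity
  omega

theorem Arc.isOver_or_isUnder_iff {α : E.Arc} :
    α.IsOver ∨ α.IsUnder ↔ ∃ k p q, α.Joins k p q := by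
  rw [Arc.isOver_iff, Arc.isUnder_iff]
  constructor
  · rintro (⟨p, q, h⟩ | ⟨p, q, h⟩)
    exacts [⟨_, p, q, h⟩, ⟨_, p, q, h⟩]
  · rintro ⟨k, p, q, h⟩
    have := h.lt_two
    obtain rfl | rfl : k = 0 ∨ k = 1 := by omega
    exacts [Or.inl ⟨p, q, h⟩, Or.inr ⟨p, q, h⟩]

theorem adjacent_inr_iff {p q : Fin E.numUpper} :
    Adjacent (E := E) (Sum.inr p) (Sum.inr q) ↔ Adj p q := by
  have key : ∀ a b : Fin E.numUpper,
      ((Sum.inr a : E.Point) ⋖ Sum.inr b) ↔ a.val + 1 = b.val := by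
    intro a b
    rw [covBy_iff_lt_and_eq_or_eq]
    constructor
    · rintro ⟨h1, h2⟩
      have hab : a.val < b.val := by simpa using h1
      have h3 := h2 (Sum.inr ⟨a.val + 1, by omega⟩) (by simp [Fin.le_def])
        (by simp [Fin.le_def]; omega)
      simp [Fin.ext_iff] at h3
      exact h3
    · intro h
      refine ⟨Sum.inr_lt_inr_iff.2 (Fin.lt_def.2 (by omega)), ?_⟩
      rintro (c | c) h1 h2
      · simp at h1
      · rw [Sum.inr_le_inr_iff, Fin.le_def] at h1 h2
        rw [Sum.inr.injEq, Sum.inr.injEq, Fin.ext_iff, Fin.ext_iff]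
        omega
  unfold Adjacent Adj
  rw [key, key]

theorem Arc.Joins.adjacent_iff {α : E.Arc} {k : ℕ} {p q : Fin E.numUpper} (h : α.Joins k p q) :
    Adjacent α.src α.tgt ↔ Adj p q := by
  rw [h.src_eq, h.tgt_eq, adjacent_inr_iff]

theorem Arc.Joins.enclosesPoint_iff {α : E.Arc} {k : ℕ} {p q x : Fin E.numUpper}
    (h : α.Joins k p q) : α.EnclosesPoint (Sum.inr x) ↔ Btw p q x := by
  simp [Arc.EnclosesPoint, h.src_eq, h.tgt_eq, Btw]

theorem Arc.Joins.kind_eq {α : E.Arc} {k : ℕ} {p q : Fin E.numUpper} (h : α.Joins k p q) :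
    α.kind = if k = 0 then ArcKind.over else ArcKind.under := by
  have h2 := h.lt_two
  obtain rfl | rfl : k = 0 ∨ k = 1 := by omega
  · exact Arc.isOver_iff.2 ⟨p, q, h⟩
  · exact Arc.isUnder_iff.2 ⟨p, q, h⟩

theorem Arc.Joins.cross_iff {α β : E.Arc} {k : ℕ} {p q p' q' : Fin E.numUpper}
    (h : α.Joins k p q) (h' : β.Joins k p' q') :
    α.Cross β ↔ Xor (Btw p q p') (Btw p q q') := by
  have h2 := h.lt_two
  unfold Arc.Cross
  rw [h.kind_eq, h'.kind_eq, h'.src_eq, h'.tgt_eq, h.enclosesPoint_iff, h.enclosesPoint_iff]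
  obtain rfl | rfl : k = 0 ∨ k = 1 := by omega
  · rfl
  · rfl

theorem over_not_cross_iff :
    (∀ α β : E.Arc, α.IsOver → β.IsOver → ¬ α.Cross β) ↔
      ∀ a b c d, E.Step 0 a b → E.Step 0 c d → ¬ Xor (Btw a b c) (Btw a b d) := by
  constructor
  · intro h a b c d h1 h2
    obtain ⟨α, hα⟩ := h1.exists_joins
    obtain ⟨β, hβ⟩ := h2.exists_joins
    rw [← hα.cross_iff hβ]
    exact h α β (Arc.isOver_iff.2 ⟨_, _, hα⟩) (Arc.isOver_iff.2 ⟨_, _, hβ⟩)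
  · intro h α β hα hβ
    obtain ⟨a, b, hα⟩ := Arc.isOver_iff.1 hα
    obtain ⟨c, d, hβ⟩ := Arc.isOver_iff.1 hβ
    rw [hα.cross_iff hβ]
    exact h a b c d hα.step hβ.step

end CurveSystem

/-! ### Deletion of upper points -/

namespace CurveSystem

variable {n : ℕ}

open Classical in
/-- The order embedding `f` identifies `E'` with the result of deleting the upper points in `S`
from `E`. -/
def Deletes (E E' : CurveSystem n) (f : Fin E'.numUpper ↪o Fin E.numUpper)
    (S : Set (Fin E.numUpper)) : Prop :=
  (∀ p, p ∈ Set.range f ↔ p ∉ S) ∧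
    ∀ i, (E'.curve i).map f = (E.curve i).filter fun p => decide (p ∉ S)

variable {E E' : CurveSystem n}

theorem Deletes.not_mem {f : Fin E'.numUpper ↪o Fin E.numUpper} {S : Set (Fin E.numUpper)}
    (h : E.Deletes E' f S) (x : Fin E'.numUpper) : f x ∉ S :=
  (h.1 _).1 ⟨x, rfl⟩

theorem Deletes.exists_eq {f : Fin E'.numUpper ↪o Fin E.numUpper} {S : Set (Fin E.numUpper)}
    (h : E.Deletes E' f S) {p : Fin E.numUpper} (hp : p ∉ S) : ∃ x, f x = p :=
  (h.1 _).2 hp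

theorem deletes_empty (E : CurveSystem n) : E.Deletes E (RelEmbedding.refl _) ∅ := by
  constructor
  · intro p
    simp
  · intro i
    simp

theorem Deletes.trans {E'' : CurveSystem n} {f : Fin E'.numUpper ↪o Fin E.numUpper}
    {S : Set (Fin E.numUpper)} {g : Fin E''.numUpper ↪o Fin E'.numUpper}
    {S' : Set (Fin E'.numUpper)} (h : E.Deletes E' f S) (h' : E'.Deletes E'' g S') :
    E.Deletes E'' (g.trans f) (S ∪ f '' S') := by
  classical
  constructor
  · intro p
    constructor
    · rintro ⟨x, rfl⟩ (hx | ⟨y, hy, hyx⟩)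
      · exact h.not_mem _ hx
      · have : y = g x := f.injective hyx
        subst this
        exact h'.not_mem _ hy
    · intro hp
      obtain ⟨x, rfl⟩ := h.exists_eq (fun hs => hp (Or.inl hs))
      obtain ⟨y, rfl⟩ := h'.exists_eq (fun hs => hp (Or.inr ⟨x, hs, rfl⟩))
      exact ⟨y, rfl⟩
  · intro i
    have h1 : (E''.curve i).map (g.trans f) = ((E''.curve i).map g).map f := by
      rw [List.map_map]
      rfl
    have h2 : (E'.curve i).filter (fun p => decide (p ∉ S')) =
        (E'.curve i).filter ((fun p => decide (p ∉ f '' S')) ∘ f) := by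
      apply List.filter_congr
      intro x _
      simp only [Function.comp_apply, f.injective.mem_set_image]
    rw [h1, h'.2 i]
    have h3 : ((E'.curve i).filter fun p => decide (p ∉ S')).map f =
        ((E'.curve i).map f).filter (fun p => decide (p ∉ f '' S')) := by
      rw [List.filter_map]
      convert congrArg (List.map f) h2 using 3
    convert h3 using 1
    rw [h.2 i, List.filter_filter]
    apply List.filter_congr
    intro x _
    rw [← Bool.decide_and]
    congr 1
    simp only [Set.mem_union, not_or]
    exact propext and_comm

/-- A strictly monotone map on `Fin N` is determined by its range, so `S` fixes the embedding, whose
injectivity recovers the curves. Diagrams are in normal form, hence this is an equality and not just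
an isomorphism. -/
theorem Deletes.unique {E₁ E₂ : CurveSystem n} {S : Set (Fin E.numUpper)}
    {f : Fin E₁.numUpper ↪o Fin E.numUpper} {g : Fin E₂.numUpper ↪o Fin E.numUpper}
    (h₁ : E.Deletes E₁ f S) (h₂ : E.Deletes E₂ g S) : E₁ = E₂ := by
  classical
  obtain ⟨N₁, c₁, a₁, b₁, d₁⟩ := E₁
  obtain ⟨N₂, c₂, a₂, b₂, d₂⟩ := E₂
  have hr : Set.range f = Set.range g := by
    ext p
    rw [h₁.1, h₂.1]
  have hN : N₁ = N₂ := by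
    have h3 := Set.ncard_range_of_injective f.injective
    have h4 := Set.ncard_range_of_injective g.injective
    rw [hr, h4] at h3
    simpa using h3.symm
  subst hN
  have hfg : (f : Fin N₁ → Fin E.numUpper) = g :=
    (StrictMono.range_inj f.strictMono g.strictMono).1 hr
  have hc : c₁ = c₂ := by
    funext i
    apply List.map_injective_iff.2 f.injective
    have h3 := h₁.2 i
    have h4 := h₂.2 i
    dsimp only at h3 h4
    rw [h3, hfg]
    exact h4.symm
  subst hc
  rfl

theorem exists_deletes (E : CurveSystem n) (S : Set (Fin E.numUpper))
    (h : ∀ i, ∃ p ∈ E.curve i, p ∉ S) : ∃ E' f, E.Deletes E' f S := by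
  classical
  let T : Finset (Fin E.numUpper) := Finset.univ.filter (· ∉ S)
  let f : Fin T.card ↪o Fin E.numUpper := T.orderEmbOfFin rfl
  have hf : ∀ p, p ∈ Set.range f ↔ p ∉ S := by
    intro p
    rw [Finset.range_orderEmbOfFin]
    simp [T]
  have hex : ∀ i, ∃ l : List (Fin T.card),
      l.map f = (E.curve i).filter fun p => decide (p ∉ S) := by
    intro i
    have : (E.curve i).filter (fun p => decide (p ∉ S)) ∈ Set.range (List.map f) := by
      rw [Set.range_list_map]
      intro x hx
      rw [hf]
      simpa using (List.mem_filter.1 hx).2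
    exact this
  choose c hc using hex
  have hmem : ∀ i x, x ∈ c i ↔ f x ∈ E.curve i := by
    intro i x
    rw [← List.mem_map_of_injective f.injective, hc, List.mem_filter]
    simp only [decide_eq_true_eq, and_iff_left_iff_imp]
    exact fun _ => (hf _).1 ⟨x, rfl⟩
  refine ⟨⟨T.card, c, ?_, ?_, ?_⟩, f, hf, ?_⟩
  · intro i hi
    obtain ⟨p, hp, hpS⟩ := h i
    obtain ⟨x, rfl⟩ := (hf p).2 hpS
    rw [← hmem, hi] at hp
    simp at hp
  · intro i
    apply List.Nodup.of_map f
    rw [hc]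
    exact (E.curve_nodup i).filter _
  · intro x
    simp only [hmem]
    exact E.existsUnique_curve (f x)
  · intro i
    convert hc i

/-- The points deleted by the simplifying move along an arc from `p` to `q`. -/
def moveSet (E : CurveSystem n) (p q : Fin E.numUpper) : Set (Fin E.numUpper) :=
  {x | x = q ∨ (x = p ∧ ¬ E.Term q)}

theorem moveSet_of_term {p q : Fin E.numUpper} (h : E.Term q) : E.moveSet p q = {q} := by
  ext x
  simp [moveSet, h]

theorem moveSet_of_not_term {p q : Fin E.numUpper} (h : ¬ E.Term q) :
    E.moveSet p q = {p, q} := by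
  ext x
  simp [moveSet, h, or_comm]

theorem Deletes.at_iff_of_term {f : Fin E'.numUpper ↪o Fin E.numUpper} {q : Fin E.numUpper}
    (h : E.Deletes E' f {q}) (hq : E.Term q) {i : Fin n} {j : ℕ} {x : Fin E'.numUpper} :
    E'.At i j x ↔ E.At i j (f x) := by
  classical
  have h1 : E'.At i j x ↔ ((E'.curve i).map f)[j]? = some (f x) := by
    rw [List.getElem?_map, Option.map_eq_some_iff]
    simp [At]
  rw [h1]
  have h2 := h.2 i
  by_cases hi : q ∈ E.curve i
  · obtain ⟨l₁, l₂, hl⟩ := List.append_of_mem hi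
    have hat : E.At i l₁.length q := by simp [At, hl]
    obtain ⟨i', j', h3, h4⟩ := term_iff.1 hq
    obtain ⟨rfl, rfl⟩ := hat.unique h3
    have hl2 : l₂ = [] := by
      cases l₂ with
      | nil => rfl
      | cons a l => exact absurd (by simp [At, hl]) (h4 a)
    subst hl2
    have hnd := E.curve_nodup i
    rw [hl] at hnd
    have hfil : (E.curve i).filter (fun p => decide (p ∉ ({q} : Set _))) = l₁ := by
      rw [hl, List.filter_append]
      simp only [Set.mem_singleton_iff, List.filter_cons, List.filter_nil]
      simp
      rintro a ha rfl
      simp [List.nodup_append] at hnd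
      exact hnd.2 a ha rfl
    have hne : f x ≠ q := h.not_mem x
    have key : l₁[j]? = some (f x) ↔ (l₁ ++ [q])[j]? = some (f x) := by
      rw [List.getElem?_append]
      split_ifs with hj
      · rfl
      · rw [List.getElem?_eq_none (by omega)]
        simp only [reduceCtorEq, List.getElem?_singleton, false_iff]
        split_ifs
        · simpa using hne.symm
        · simp
    have h5 : (E'.curve i).map f = l₁ := by
      rw [h2]
      convert hfil
    unfold At
    rw [h5, hl]
    exact key
  · unfold At
    rw [h2, List.filter_eq_self.2]
    rintro a ha
    simp only [Set.mem_singleton_iff, decide_eq_true_eq]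
    rintro rfl
    exact hi ha

/-- Removing two consecutive entries shifts the later indices by two. This preserves parity, hence
the types of the remaining arcs. -/
theorem Deletes.at_iff_of_pair {f : Fin E'.numUpper ↪o Fin E.numUpper} {p q : Fin E.numUpper}
    (h : E.Deletes E' f {p, q}) {i₀ : Fin n} {j₀ : ℕ} (hp : E.At i₀ j₀ p)
    (hq : E.At i₀ (j₀ + 1) q) {i : Fin n} {j : ℕ} {x : Fin E'.numUpper} :
    E'.At i j x ↔ E.At i (if i = i₀ ∧ j₀ ≤ j then j + 2 else j) (f x) := by
  classical
  have h1 : E'.At i j x ↔ ((E'.curve i).map f)[j]? = some (f x) := by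
    rw [List.getElem?_map, Option.map_eq_some_iff]
    simp [At]
  rw [h1]
  have h2 := h.2 i
  by_cases hi : i = i₀
  · subst hi
    have hlen : j₀ + 1 < (E.curve i).length := (List.getElem?_eq_some_iff.1 hq).1
    have hl : E.curve i = (E.curve i).take j₀ ++ p :: q :: (E.curve i).drop (j₀ + 2) := by
      have e1 : (E.curve i)[j₀] = p := (List.getElem?_eq_some_iff.1 hp).2
      have e2 : (E.curve i)[j₀ + 1] = q := (List.getElem?_eq_some_iff.1 hq).2
      conv_lhs => rw [← List.take_append_drop j₀ (E.curve i)]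
      rw [List.drop_eq_getElem_cons (by omega), List.drop_eq_getElem_cons hlen, e1, e2]
    have hl1 : ((E.curve i).take j₀).length = j₀ := by simp; omega
    generalize (E.curve i).take j₀ = l₁ at hl hl1
    generalize (E.curve i).drop (j₀ + 2) = l₂ at hl
    have hnd := E.curve_nodup i
    rw [hl] at hnd
    have hfil : (E.curve i).filter (fun x => decide (x ∉ ({p, q} : Set _))) = l₁ ++ l₂ := by
      rw [hl, List.filter_append]
      simp only [List.nodup_append, List.nodup_cons, List.mem_cons, not_or] at hnd
      obtain ⟨-, ⟨⟨-, h2⟩, h3, -⟩, h4⟩ := hnd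
      congr 1
      · rw [List.filter_eq_self]
        intro a ha
        simp only [Set.mem_insert_iff, Set.mem_singleton_iff, decide_eq_true_eq, not_or]
        exact ⟨fun e => h4 a ha p (Or.inl rfl) e, fun e => h4 a ha q (Or.inr (Or.inl rfl)) e⟩
      · rw [List.filter_cons_of_neg (by simp), List.filter_cons_of_neg (by simp),
          List.filter_eq_self]
        intro a ha
        simp only [Set.mem_insert_iff, Set.mem_singleton_iff, decide_eq_true_eq, not_or]
        constructor
        · rintro rfl
          exact h2 ha
        · rintro rfl
          exact h3 ha
    have key : (l₁ ++ l₂)[j]? =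
        (l₁ ++ p :: q :: l₂)[if i = i ∧ j₀ ≤ j then j + 2 else j]? := by
      by_cases hj : j₀ ≤ j
      · rw [if_pos ⟨rfl, hj⟩, List.getElem?_append_right (by omega),
          List.getElem?_append_right (by omega), hl1,
          show j + 2 - j₀ = (j - j₀) + 1 + 1 by omega, List.getElem?_cons_succ,
          List.getElem?_cons_succ]
      · rw [if_neg (by tauto), List.getElem?_append_left (by omega),
          List.getElem?_append_left (by omega)]
    have h5 : (E'.curve i).map f = l₁ ++ l₂ := by
      rw [h2]
      convert hfil
    unfold At
    rw [h5, hl, key]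
  · rw [if_neg (by tauto)]
    unfold At
    rw [h2]
    convert Iff.rfl using 3
    symm
    rw [List.filter_eq_self]
    rintro a ha
    simp only [Set.mem_insert_iff, Set.mem_singleton_iff, decide_eq_true_eq, not_or]
    constructor
    · rintro rfl
      exact hi ((E.existsUnique_curve a).unique ha hp.mem)
    · rintro rfl
      exact hi ((E.existsUnique_curve a).unique ha hq.mem)

end CurveSystem

/-! ### Effect of a simplifying move on arcs, terminal points and crossings -/

namespace CurveSystem

variable {n : ℕ} {E E' : CurveSystem n}

theorem Deletes.at_iff_of_next {f : Fin E'.numUpper ↪o Fin E.numUpper} {p q : Fin E.numUpper}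
    (hpq : E.Next p q) (hq : ¬ E.Term q) (h : E.Deletes E' f (E.moveSet p q)) :
    ∃ i₀ j₀, E.At i₀ j₀ p ∧ E.At i₀ (j₀ + 1) q ∧ ∀ i j x,
      (E'.At i j x ↔ E.At i (if i = i₀ ∧ j₀ ≤ j then j + 2 else j) (f x)) := by
  obtain ⟨i₀, j₀, h1, h2⟩ := hpq
  rw [moveSet_of_not_term hq] at h
  exact ⟨i₀, j₀, h1, h2, fun i j x => h.at_iff_of_pair h1 h2⟩

theorem Deletes.next {f : Fin E'.numUpper ↪o Fin E.numUpper} {p q : Fin E.numUpper}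
    (hpq : E.Next p q) (h : E.Deletes E' f (E.moveSet p q)) {x y : Fin E'.numUpper}
    (hxy : E.Next (f x) (f y)) : E'.Next x y := by
  by_cases hq : E.Term q
  · rw [moveSet_of_term hq] at h
    obtain ⟨i, j, h1, h2⟩ := hxy
    exact ⟨i, j, (h.at_iff_of_term hq).2 h1, (h.at_iff_of_term hq).2 h2⟩
  · obtain ⟨i₀, j₀, -, -, hat⟩ := h.at_iff_of_next hpq hq
    obtain ⟨i, j, h1, h2⟩ := hxy
    obtain ⟨a, J, hx⟩ := exists_at x
    obtain ⟨b, K, hy⟩ := exists_at y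
    obtain ⟨rfl, hJ⟩ := ((hat _ _ _).1 hx).unique h1
    obtain ⟨rfl, hK⟩ := ((hat _ _ _).1 hy).unique h2
    obtain rfl : K = J + 1 := by
      split_ifs at hJ hK with h3 h4 h4 <;> omega
    exact ⟨_, J, hx, hy⟩

/-- A new arc is inherited or, after a B-move, replaces the three arcs through `f x`, `p`, `q`, `f
y`. By alternation the outer two of these have its type. -/
theorem Deletes.step_of_step {f : Fin E'.numUpper ↪o Fin E.numUpper} {p q : Fin E.numUpper}
    (hpq : E.Next p q) (h : E.Deletes E' f (E.moveSet p q)) {k : ℕ} {x y : Fin E'.numUpper}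
    (hxy : E'.Step k x y) :
    E.Step k (f x) (f y) ∨ (E.Step k (f x) p ∧ E.Step k q (f y) ∧ ¬ E.Term q) := by
  by_cases hq : E.Term q
  · rw [moveSet_of_term hq] at h
    obtain ⟨i, j, h1, h2, h3⟩ := hxy
    exact Or.inl ⟨i, j, (h.at_iff_of_term hq).1 h1, (h.at_iff_of_term hq).1 h2, h3⟩
  · obtain ⟨i₀, j₀, hp, hq', hat⟩ := h.at_iff_of_next hpq hq
    obtain ⟨i, j, h1, h2, h3⟩ := hxy
    rw [hat] at h1 h2
    by_cases hi : i = i₀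
    · subst hi
      simp only [true_and] at h1 h2
      rcases lt_trichotomy (j + 1) j₀ with hj | hj | hj
      · rw [if_neg (by omega)] at h1 h2
        exact Or.inl ⟨i, j, h1, h2, h3⟩
      · subst hj
        rw [if_neg (by omega)] at h1
        rw [if_pos (by omega)] at h2
        exact Or.inr ⟨⟨i, j, h1, hp, h3⟩, ⟨i, j + 1 + 1, hq', h2, by omega⟩, hq⟩
      · rw [if_pos (by omega)] at h1 h2
        exact Or.inl ⟨i, j + 2, h1, h2, by omega⟩
    · rw [if_neg (by tauto)] at h1 h2
      exact Or.inl ⟨i, j, h1, h2, h3⟩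

/-- If the successor of `f x` is deleted, it must be `p`, in a B-move, and the successor of `q`
replaces it. The excluded point `p` survives only a T-move and then becomes terminal
(`Deletes.term_of_eq`). -/
theorem Deletes.term_iff {f : Fin E'.numUpper ↪o Fin E.numUpper} {p q : Fin E.numUpper}
    (hpq : E.Next p q) (h : E.Deletes E' f (E.moveSet p q)) {x : Fin E'.numUpper}
    (hx : f x ≠ p) : E'.Term x ↔ E.Term (f x) := by
  rw [← not_iff_not, not_term_iff, not_term_iff]
  constructor
  · rintro ⟨y, hy⟩
    obtain ⟨k, -, hk⟩ := hy.exists_step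
    obtain h1 | ⟨h1, -⟩ := h.step_of_step hpq hk
    exacts [⟨_, h1.next⟩, ⟨_, h1.next⟩]
  · rintro ⟨w, hw⟩
    by_cases hwS : w ∈ E.moveSet p q
    · rcases hwS with rfl | ⟨rfl, hq⟩
      · exact absurd (hw.left_unique hpq) hx
      · obtain ⟨i₀, j₀, hp, hq', hat⟩ := h.at_iff_of_next hpq hq
        obtain ⟨z, hz⟩ := not_term_iff.1 hq
        have hzS : z ∉ E.moveSet w q := by
          rintro (rfl | ⟨rfl, -⟩)
          · exact hz.ne rfl
          · exact hpq.irrefl_two hz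
        obtain ⟨z, rfl⟩ := h.exists_eq hzS
        obtain ⟨i, j, h1, h2⟩ := hz
        obtain ⟨rfl, rfl⟩ := h1.unique hq'
        obtain ⟨i', j', h3, h4⟩ := hw
        obtain ⟨rfl, rfl⟩ := h4.unique hp
        refine ⟨z, i', j', (hat _ _ _).2 ?_, (hat _ _ _).2 ?_⟩
        · rw [if_neg (by omega)]
          exact h3
        · rw [if_pos (by simp)]
          exact h2
    · obtain ⟨y, rfl⟩ := h.exists_eq hwS
      exact ⟨y, h.next hpq hw⟩

theorem Deletes.term_of_eq {f : Fin E'.numUpper ↪o Fin E.numUpper} {p q : Fin E.numUpper}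
    (hpq : E.Next p q) (h : E.Deletes E' f (E.moveSet p q)) {x : Fin E'.numUpper}
    (hx : f x = p) : E'.Term x := by
  by_contra hn
  obtain ⟨y, hy⟩ := not_term_iff.1 hn
  obtain ⟨k, -, hk⟩ := hy.exists_step
  subst hx
  obtain h1 | ⟨h1, -⟩ := h.step_of_step hpq hk
  · exact h.not_mem y (Or.inl (h1.next.right_unique hpq))
  · exact h1.next.ne rfl

theorem Deletes.adj {f : Fin E'.numUpper ↪o Fin E.numUpper} {x y : Fin E'.numUpper}
    (h : Adj (f x) (f y)) : Adj x y := by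
  have key : ∀ x y : Fin E'.numUpper, (f x).val + 1 = (f y).val → x.val + 1 = y.val := by
    intro x y hxy
    have h1 : x < y := f.lt_iff_lt.1 (Fin.lt_def.2 (by omega))
    by_contra hne
    have h2 : x.val < y.val := h1
    have h3 : f x < f ⟨x.val + 1, by omega⟩ := f.lt_iff_lt.2 (Fin.lt_def.2 (by simp))
    have h4 : f ⟨x.val + 1, by omega⟩ < f y :=
      f.lt_iff_lt.2 (Fin.lt_def.2 (by dsimp only; omega))
    rw [Fin.lt_def] at h3 h4
    omega
  rcases h with h | h
  exacts [Or.inl (key _ _ h), Or.inr (key _ _ h)]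

theorem xor_btw_comm {a b c d : ℕ} (h1 : a ≠ c) (h2 : a ≠ d) (h3 : b ≠ c) (h4 : b ≠ d) :
    Xor (Btw a b c) (Btw a b d) ↔ Xor (Btw c d a) (Btw c d b) := by
  unfold Btw Xor
  omega

theorem btw_iff_of_adj {N : ℕ} {p q : Fin N} (h : Adj p q) {a b : ℕ} (h1 : a ≠ p)
    (h2 : a ≠ q) (h3 : b ≠ p) (h4 : b ≠ q) : Btw a b p ↔ Btw a b q := by
  unfold Btw Adj at *
  omega

theorem btw_map_iff {f : Fin E'.numUpper ↪o Fin E.numUpper} {x y z : Fin E'.numUpper} :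
    Btw (f x) (f y) (f z) ↔ Btw x y z := by
  unfold Btw
  simp only [← Fin.lt_def, f.lt_iff_lt]

/-- A merged over arc comes from an over arc ending at `p` and one starting at `q`. Another over arc
separates the ends of neither, and cannot separate the adjacent points `p` and `q`, so it does not
separate the ends of the merged arc. -/
theorem Deletes.over_not_cross {f : Fin E'.numUpper ↪o Fin E.numUpper} {p q : Fin E.numUpper}
    (hpq : E.Next p q) (hadj : Adj p q) (h : E.Deletes E' f (E.moveSet p q))
    (hE : ∀ α β : E.Arc, α.IsOver → β.IsOver → ¬ α.Cross β) :
    ∀ α β : E'.Arc, α.IsOver → β.IsOver → ¬ α.Cross β := by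
  rw [over_not_cross_iff] at hE ⊢
  have mixed : ∀ a b c d : Fin E'.numUpper, E.Step 0 (f a) (f b) → E.Step 0 (f c) p →
      E.Step 0 q (f d) → ¬ E.Term q → ¬ Xor (Btw a b c) (Btw a b d) := by
    intro a b c d h1 h2 h3 hq
    rw [← btw_map_iff (f := f), ← btw_map_iff (f := f)]
    have hne : ∀ x, (f x).val ≠ p.val ∧ (f x).val ≠ q.val := by
      intro x
      have := h.not_mem x
      rw [moveSet_of_not_term hq] at this
      simpa [Fin.ext_iff] using this
    have h4 := hE _ _ _ _ h1 h2
    have h5 := hE _ _ _ _ h1 h3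
    rw [btw_iff_of_adj hadj (hne a).1 (hne a).2 (hne b).1 (hne b).2] at h4
    unfold Xor at *
    tauto
  intro a b c d h1 h2
  obtain h3 | ⟨h3, h3', hq⟩ := h.step_of_step hpq h1 <;>
    obtain h4 | ⟨h4, h4', hq'⟩ := h.step_of_step hpq h2
  · rw [← btw_map_iff (f := f), ← btw_map_iff (f := f)]
    exact hE _ _ _ _ h3 h4
  · exact mixed a b c d h3 h4 h4' hq'
  -- Interleaving is symmetric in the two arcs only if they share no endpoint.
  · have hne : a ≠ c ∧ a ≠ d ∧ b ≠ c ∧ b ≠ d := by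
      refine ⟨?_, ?_, ?_, ?_⟩ <;> rintro rfl
      · have := h3.next.right_unique h4.next
        exact h.not_mem d (Or.inr ⟨this.symm, hq⟩)
      · exact h2.not_consecutive h1
      · exact h1.not_consecutive h2
      · have := h3'.next.left_unique h4.next
        exact h.not_mem c (Or.inl this.symm)
    simp only [ne_eq, Fin.ext_iff] at hne
    rw [xor_btw_comm hne.1 hne.2.1 hne.2.2.1 hne.2.2.2]
    exact mixed c d a b h4 h3 h3' hq
  -- A B-move merges only one arc, so here the two arcs coincide.
  · have h5 : f a = f c := h3.next.left_unique h4.next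
    have h6 : f b = f d := h3'.next.right_unique h4'.next
    rw [f.injective h5, f.injective h6]
    simp [Btw, Xor]

end CurveSystem

/-! ### Simplifying moves as deletions along adjacent consecutive points -/

namespace VCD

variable {n : ℕ}

/-- No curve is emptied: a T-move leaves `p` on the only affected curve, and a B-move deletes no
terminal point. -/
theorem exists_deletes_moveSet (E : VCD n) {p q : Fin E.numUpper} (hpq : E.Next p q)
    (hadj : Adj p q) :
    ∃ (E' : VCD n) (f : _), E.Deletes E'.toCurveSystem f (E.moveSet p q) := by
  obtain ⟨E', f, h⟩ := exists_deletes E.toCurveSystem (E.moveSet p q) (by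
    intro i
    by_cases hq : E.Term q
    · rw [moveSet_of_term hq]
      obtain ⟨i', j, h1, h2⟩ := hpq
      by_cases hi : i = i'
      · subst hi
        refine ⟨p, h1.mem, ?_⟩
        rintro rfl
        have := (h1.unique h2).2
        omega
      · obtain ⟨r, hr⟩ := List.exists_mem_of_ne_nil _ (E.curve_ne_nil i)
        refine ⟨r, hr, ?_⟩
        rintro rfl
        exact hi ((E.existsUnique_curve r).unique hr h2.mem)
    · rw [moveSet_of_not_term hq]
      have ht : E.Term ((E.curve i).getLast (E.curve_ne_nil i)) := ⟨i, rfl⟩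
      refine ⟨_, List.getLast_mem (E.curve_ne_nil i), ?_⟩
      rintro (h1 | h1)
      · exact hpq.not_term (h1 ▸ ht)
      · exact hq (h1 ▸ ht))
  exact ⟨⟨E', h.over_not_cross hpq hadj E.over_not_cross⟩, f, h⟩

/-- A simplifying move, along an arc between adjacent upper points. -/
def Move (E E' : VCD n) : Prop :=
  ∃ p q, E.Next p q ∧ Adj p q ∧ ∃ f, E.Deletes E'.toCurveSystem f (E.moveSet p q)

theorem eq_of_toCurveSystem_eq {E E' : VCD n} (h : E.toCurveSystem = E'.toCurveSystem) :
    E = E' := by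
  cases E
  cases E'
  congr

theorem isDeletion_iff {E E' : VCD n} {S : Set E.Point} :
    IsDeletion E E' S ↔ ∃ f, E.Deletes E'.toCurveSystem f {p | Sum.inr p ∈ S} :=
  Iff.rfl

theorem simplifyingT_iff {E E' : VCD n} : E.SimplifyingT E' ↔
    ∃ p q, E.Next p q ∧ Adj p q ∧ E.Term q ∧ ∃ f, E.Deletes E'.toCurveSystem f {q} := by
  have hset : ∀ q : Fin E.numUpper, {x | (Sum.inr x : E.Point) ∈ ({Sum.inr q} : Set E.Point)} =
      ({q} : Set (Fin E.numUpper)) := by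
    intro q
    ext x
    simp
  constructor
  · rintro ⟨α, h1, h2, h3, h4⟩
    obtain ⟨k, p, q, hj⟩ := Arc.isOver_or_isUnder_iff.1 h1
    rw [isDeletion_iff, hj.tgt_eq, hset] at h4
    rw [hj.tgt_eq] at h3
    exact ⟨p, q, hj.step.next, hj.adjacent_iff.1 h2, h3, h4⟩
  · rintro ⟨p, q, h1, h2, h3, h4⟩
    obtain ⟨k, -, hk⟩ := h1.exists_step
    obtain ⟨α, hα⟩ := hk.exists_joins
    refine ⟨α, Arc.isOver_or_isUnder_iff.2 ⟨k, p, q, hα⟩, hα.adjacent_iff.2 h2, ?_, ?_⟩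
    · rw [hα.tgt_eq]
      exact h3
    · rw [isDeletion_iff, hα.tgt_eq, hset]
      exact h4

theorem simplifyingB_iff {E E' : VCD n} : E.SimplifyingB E' ↔
    ∃ p q, E.Next p q ∧ Adj p q ∧ ¬ E.Term q ∧ ∃ f, E.Deletes E'.toCurveSystem f {p, q} := by
  have hset : ∀ p q : Fin E.numUpper,
      {x | (Sum.inr x : E.Point) ∈ ({Sum.inr p, Sum.inr q} : Set E.Point)} =
      ({p, q} : Set (Fin E.numUpper)) := by
    intro p q
    ext x
    simp
  constructor
  · rintro ⟨α, h1, h2, h3, h4⟩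
    obtain ⟨k, p, q, hj⟩ := Arc.isOver_or_isUnder_iff.1 h1
    rw [isDeletion_iff, hj.tgt_eq, hj.src_eq, hset] at h4
    rw [hj.tgt_eq] at h3
    exact ⟨p, q, hj.step.next, hj.adjacent_iff.1 h2, h3, h4⟩
  · rintro ⟨p, q, h1, h2, h3, h4⟩
    obtain ⟨k, -, hk⟩ := h1.exists_step
    obtain ⟨α, hα⟩ := hk.exists_joins
    refine ⟨α, Arc.isOver_or_isUnder_iff.2 ⟨k, p, q, hα⟩, hα.adjacent_iff.2 h2, ?_, ?_⟩
    · rw [hα.tgt_eq]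
      exact h3
    · rw [isDeletion_iff, hα.tgt_eq, hα.src_eq, hset]
      exact h4

theorem move_iff {E E' : VCD n} : E.Move E' ↔ E.SimplifyingT E' ∨ E.SimplifyingB E' := by
  rw [simplifyingT_iff, simplifyingB_iff]
  constructor
  · rintro ⟨p, q, h1, h2, h3⟩
    by_cases hq : E.Term q
    · rw [moveSet_of_term hq] at h3
      exact Or.inl ⟨p, q, h1, h2, hq, h3⟩
    · rw [moveSet_of_not_term hq] at h3
      exact Or.inr ⟨p, q, h1, h2, hq, h3⟩
  · rintro (⟨p, q, h1, h2, hq, h3⟩ | ⟨p, q, h1, h2, hq, h3⟩)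
    · exact ⟨p, q, h1, h2, by rwa [moveSet_of_term hq]⟩
    · exact ⟨p, q, h1, h2, by rwa [moveSet_of_not_term hq]⟩

theorem simplified_iff {E : VCD n} : E.Simplified ↔ ∀ p q, E.Next p q → ¬ Adj p q := by
  unfold Simplified
  simp only [← move_iff]
  constructor
  · intro h p q h1 h2
    obtain ⟨E', f, hf⟩ := E.exists_deletes_moveSet h1 h2
    exact h ⟨E', p, q, h1, h2, f, hf⟩
  · rintro h ⟨E', p, q, h1, h2, -⟩
    exact h p q h1 h2

end VCD

/-! ### Confluence of simplifying moves, and deletion of nests -/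

namespace CurveSystem

variable {n : ℕ} {E E' : CurveSystem n}

/-- The points `a`, `b`, `c` occupy three consecutive places both on their curve and in the chain of
upper points. Whether `a` or `c` is the one that survives, it has the same place in both orders. -/
theorem Deletes.shift {f : Fin E'.numUpper ↪o Fin E.numUpper} {a b c : Fin E.numUpper}
    (hab : E.Next a b) (hbc : E.Next b c) (hab' : Adj a b) (hbc' : Adj b c)
    (h : E.Deletes E' f {a, b}) : ∃ g, E.Deletes E' g {b, c} := by
  classical
  have hac : a ≠ c := by
    rintro rfl
    exact hab.irrefl_two hbc
  have hf : ∀ x, f x ≠ a ∧ f x ≠ b := by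
    intro x
    have := h.not_mem x
    simpa using this
  -- The new embedding moves the survivor from `c` to `a`. Only `b` lies between them, and `f` omits
  -- `a` and `b`.
  have hmono : StrictMono fun x => if f x = c then a else f x := by
    intro x y hxy
    have h1 : (f x).val < (f y).val := f.lt_iff_lt.2 hxy
    have h2 := hf x
    have h3 := hf y
    dsimp only
    rw [Fin.lt_def]
    unfold Adj at hab' hbc'
    simp only [ne_eq, Fin.ext_iff] at *
    split_ifs <;> omega
  refine ⟨OrderEmbedding.ofStrictMono _ hmono, ?_, ?_⟩
  · intro p
    simp only [Set.mem_range, OrderEmbedding.coe_ofStrictMono, Set.mem_insert_iff,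
      Set.mem_singleton_iff, not_or]
    constructor
    · rintro ⟨x, rfl⟩
      split_ifs with h1
      · exact ⟨hab.ne, hac⟩
      · exact ⟨(hf x).2, h1⟩
    · rintro ⟨h1, h2⟩
      by_cases hpa : p = a
      · obtain ⟨x, hx⟩ := h.exists_eq (p := c) (by
          rintro (h3 | h3)
          · exact hac h3.symm
          · exact hbc.ne h3.symm)
        exact ⟨x, by rw [if_pos hx, hpa]⟩
      · obtain ⟨x, rfl⟩ := h.exists_eq (p := p) (by
          rintro (h3 | h3)
          · exact hpa h3
          · exact h1 h3)
        exact ⟨x, if_neg h2⟩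
  · intro i
    have h1 : (E'.curve i).map (OrderEmbedding.ofStrictMono _ hmono) =
        ((E'.curve i).map f).map fun p => if p = c then a else p := by
      rw [List.map_map]
      rfl
    rw [h1, h.2 i]
    have h2 : (E.curve i).filter (fun x => decide (x ∉ ({a, b} : Set _))) =
        (E.curve i).filter (fun x => x ≠ a ∧ x ≠ b) := by
      apply List.filter_congr
      intro x _
      simp
    have h3 : (E.curve i).filter (fun x => decide (x ∉ ({b, c} : Set _))) =
        (E.curve i).filter (fun x => x ≠ b ∧ x ≠ c) := by
      apply List.filter_congr
      intro x _
      simp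
    convert_to ((E.curve i).filter (fun x => x ≠ a ∧ x ≠ b)).map
      (fun p => if p = c then a else p) = (E.curve i).filter (fun x => x ≠ b ∧ x ≠ c)
    · convert congrArg (List.map fun p => if p = c then a else p) h2
    · convert h3
    obtain ⟨i₀, j₀, ha, hb⟩ := hab
    obtain ⟨i₁, j₁, hb', hc⟩ := hbc
    obtain ⟨rfl, rfl⟩ := hb.unique hb'
    have hnd := E.curve_nodup i
    by_cases hi : i = i₀
    · subst hi
      have hlen : j₀ + 1 + 1 < (E.curve i).length := (List.getElem?_eq_some_iff.1 hc).1
      have hl : E.curve i = (E.curve i).take j₀ ++ a :: b :: c :: (E.curve i).drop (j₀ + 3) := by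
        have e1 : (E.curve i)[j₀] = a := (List.getElem?_eq_some_iff.1 ha).2
        have e2 : (E.curve i)[j₀ + 1] = b := (List.getElem?_eq_some_iff.1 hb).2
        have e3 : (E.curve i)[j₀ + 1 + 1] = c := (List.getElem?_eq_some_iff.1 hc).2
        conv_lhs => rw [← List.take_append_drop j₀ (E.curve i)]
        rw [List.drop_eq_getElem_cons (by omega), List.drop_eq_getElem_cons (by omega),
          List.drop_eq_getElem_cons hlen, e1, e2, e3]
      generalize (E.curve i).take j₀ = l₁ at hl
      generalize (E.curve i).drop (j₀ + 3) = l₂ at hl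
      rw [hl] at hnd ⊢
      simp only [List.nodup_append, List.nodup_cons, List.mem_cons, not_or] at hnd
      obtain ⟨-, ⟨⟨h12, h13, h1⟩, ⟨h23, h2⟩, h3, -⟩, h4⟩ := hnd
      have h5 : ∀ l : List (Fin E.numUpper), a ∉ l → b ∉ l → c ∉ l →
          (l.filter (fun x => x ≠ a ∧ x ≠ b)).map (fun p => if p = c then a else p) =
            l.filter (fun x => x ≠ b ∧ x ≠ c) := by
        intro l ha hb hc
        rw [List.filter_eq_self.2, List.filter_eq_self.2, List.map_congr_left (g := id),
          List.map_id]
        · intro x hx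
          exact if_neg (by rintro rfl; exact hc hx)
        · intro x hx
          simp only [decide_eq_true_eq]
          constructor
          · rintro rfl; exact hb hx
          · rintro rfl; exact hc hx
        · intro x hx
          simp only [decide_eq_true_eq]
          constructor
          · rintro rfl; exact ha hx
          · rintro rfl; exact hb hx
      rw [List.filter_append, List.filter_append, List.map_append,
        h5 l₁ (fun h => h4 a h a (Or.inl rfl) rfl) (fun h => h4 b h b (by simp) rfl)
          (fun h => h4 c h c (by simp) rfl)]
      congr 1
      rw [List.filter_cons_of_neg (by simp), List.filter_cons_of_neg (by simp),
        List.filter_cons_of_pos (by simp; tauto), List.filter_cons_of_pos (by simp; tauto),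
        List.filter_cons_of_neg (by simp), List.filter_cons_of_neg (by simp), List.map_cons,
        if_pos rfl, h5 l₂ h1 h2 h3]
    · have h6 : ∀ x, ∀ j, E.At i₀ j x → x ∉ E.curve i := fun x j hx hx' =>
        hi ((E.existsUnique_curve x).unique hx' hx.mem)
      rw [List.filter_eq_self.2, List.filter_eq_self.2, List.map_congr_left (g := id),
        List.map_id]
      · intro x hx
        exact if_neg (by rintro rfl; exact h6 _ _ hc hx)
      · intro x hx
        simp only [decide_eq_true_eq]
        constructor
        · rintro rfl; exact h6 _ _ hb hx
        · rintro rfl; exact h6 _ _ hc hx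
      · intro x hx
        simp only [decide_eq_true_eq]
        constructor
        · rintro rfl; exact h6 _ _ ha hx
        · rintro rfl; exact h6 _ _ hb hx

theorem Deletes.image_moveSet {f : Fin E'.numUpper ↪o Fin E.numUpper} {p q : Fin E.numUpper}
    (hpq : E.Next p q) (h : E.Deletes E' f (E.moveSet p q)) {x y : Fin E'.numUpper}
    (hy : f y ≠ p) : f '' E'.moveSet x y = E.moveSet (f x) (f y) := by
  by_cases ht : E'.Term y
  · rw [moveSet_of_term ht, moveSet_of_term ((h.term_iff hpq hy).1 ht), Set.image_singleton]
  · rw [moveSet_of_not_term ht, moveSet_of_not_term (mt (h.term_iff hpq hy).2 ht),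
      Set.image_pair]

end CurveSystem

namespace VCD

variable {n : ℕ}

theorem eq_of_deletes {E E₁ E₂ : VCD n} {S : Set (Fin E.numUpper)} {f g}
    (h₁ : E.Deletes E₁.toCurveSystem f S) (h₂ : E.Deletes E₂.toCurveSystem g S) : E₁ = E₂ :=
  eq_of_toCurveSystem_eq (h₁.unique h₂)

/-- Describing the target as the deletion of a union from `E` makes it symmetric in the two pairs,
so both orders reach the same diagram. -/
theorem exists_move_of_disjoint {E E₁ : VCD n} {p q x y : Fin E.numUpper} {f}
    (hpq : E.Next p q) (h : E.Deletes E₁.toCurveSystem f (E.moveSet p q)) (hxy : E.Next x y)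
    (hadj : Adj x y) (h1 : x ≠ p) (h2 : x ≠ q) (h3 : y ≠ p) (h4 : y ≠ q) :
    ∃ D, E₁.Move D ∧ ∃ g, E.Deletes D.toCurveSystem g (E.moveSet p q ∪ E.moveSet x y) := by
  obtain ⟨x, rfl⟩ := h.exists_eq (p := x) (by rintro (h | ⟨h, -⟩) <;> contradiction)
  obtain ⟨y, rfl⟩ := h.exists_eq (p := y) (by rintro (h | ⟨h, -⟩) <;> contradiction)
  have hxy' := h.next hpq hxy
  have hadj' : Adj x y := Deletes.adj hadj
  obtain ⟨D, g, hD⟩ := E₁.exists_deletes_moveSet hxy' hadj'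
  refine ⟨D, ⟨x, y, hxy', hadj', g, hD⟩, g.trans f, ?_⟩
  rw [← h.image_moveSet hpq h3]
  exact h.trans hD

/-- By `Deletes.shift`, deleting `{p, q}` amounts to deleting `{q, r}`. If `r` is terminal, the move
along `q, r` deletes only `r`; then `q` has become terminal and the T-move along `p, q` deletes it.
-/
theorem eq_or_move_of_consecutive {E E₁ E₂ : VCD n} {p q r : Fin E.numUpper} {f g}
    (hpq : E.Next p q) (hqr : E.Next q r) (hpq' : Adj p q) (hqr' : Adj q r)
    (h₁ : E.Deletes E₁.toCurveSystem f (E.moveSet p q))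
    (h₂ : E.Deletes E₂.toCurveSystem g (E.moveSet q r)) : E₁ = E₂ ∨ E₂.Move E₁ := by
  rw [moveSet_of_not_term hqr.not_term] at h₁
  obtain ⟨f', h₁'⟩ := h₁.shift hpq hqr hpq' hqr'
  by_cases hr : E.Term r
  · right
    have h2 := h₂
    rw [moveSet_of_term hr] at h2
    have hpr : p ≠ r := by
      rintro rfl
      exact hpq.irrefl_two hqr
    obtain ⟨p, rfl⟩ := h2.exists_eq (p := p) hpr
    obtain ⟨q, rfl⟩ := h2.exists_eq (p := q) hqr.ne
    have hpq₂ := h₂.next hqr hpq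
    have hadj₂ : Adj p q := Deletes.adj hpq'
    obtain ⟨D, k, hD⟩ := E₂.exists_deletes_moveSet hpq₂ hadj₂
    have hq : E₂.Term q := h₂.term_of_eq hqr rfl
    have hD' := hD
    rw [moveSet_of_term hq] at hD'
    have h3 := h2.trans hD'
    rw [Set.image_singleton, Set.singleton_union, Set.pair_comm] at h3
    obtain rfl := eq_of_deletes h₁' h3
    exact ⟨p, q, hpq₂, hadj₂, k, hD⟩
  · rw [moveSet_of_not_term hr] at h₂
    exact Or.inl (eq_of_deletes h₁' h₂)

/-- Distinct pairs overlap only head to tail, as predecessors and successors are unique. The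
asymmetric conclusion is the hypothesis of `Relation.equivalence_join_reflTransGen`. -/
theorem Move.diamond {E E₁ E₂ : VCD n} (h₁ : E.Move E₁) (h₂ : E.Move E₂) :
    ∃ D, Relation.ReflGen Move E₁ D ∧ Relation.ReflTransGen Move E₂ D := by
  obtain ⟨p, q, h1, h1', f, hf⟩ := h₁
  obtain ⟨x, y, h2, h2', g, hg⟩ := h₂
  by_cases hqx : q = x
  · subst hqx
    obtain rfl | h := eq_or_move_of_consecutive h1 h2 h1' h2' hf hg
    exacts [⟨E₁, .refl, .refl⟩, ⟨E₁, .refl, .single h⟩]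
  by_cases hyp : y = p
  · subst hyp
    obtain rfl | h := eq_or_move_of_consecutive h2 h1 h2' h1' hg hf
    exacts [⟨E₂, .refl, .refl⟩, ⟨E₂, .single h, .refl⟩]
  by_cases hpx : p = x
  · subst hpx
    obtain rfl := h1.right_unique h2
    obtain rfl := eq_of_deletes hf hg
    exact ⟨E₁, .refl, .refl⟩
  by_cases hqy : q = y
  · subst hqy
    exact absurd (h1.left_unique h2) hpx
  obtain ⟨D, hD, k, hk⟩ := exists_move_of_disjoint h1 hf h2 h2' (Ne.symm hpx) (Ne.symm hqx) hyp
    (Ne.symm hqy)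
  obtain ⟨D', hD', k', hk'⟩ := exists_move_of_disjoint h2 hg h1 h1' hpx (Ne.symm hyp) hqx hqy
  rw [Set.union_comm] at hk'
  obtain rfl := eq_of_deletes hk hk'
  exact ⟨D, .single hD, .single hD'⟩

theorem join_of_eqvGen {E₁ E₂ : VCD n}
    (h : Relation.EqvGen (Relation.ReflTransGen Move) E₁ E₂) :
    Relation.Join (Relation.ReflTransGen Move) E₁ E₂ := by
  have heq : Equivalence (Relation.Join (Relation.ReflTransGen (Move (n := n)))) :=
    Relation.equivalence_join_reflTransGen fun _ _ _ => Move.diamond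
  induction h with
  | rel a b h => exact ⟨b, h, .refl⟩
  | refl a => exact heq.refl a
  | symm a b _ ih => exact heq.symm ih
  | trans a b c _ _ ih₁ ih₂ => exact heq.trans ih₁ ih₂

theorem Simplified.eq_of_reflTransGen {E E' : VCD n} (hE : E.Simplified)
    (h : Relation.ReflTransGen Move E E') : E = E' := by
  rcases Relation.ReflTransGen.cases_head h with h | ⟨D, h, -⟩
  · exact h
  · exact absurd ⟨D, move_iff.1 h⟩ hE

/-- A nest of arcs, none of which ends at a terminal point, can be deleted by simplifying moves. -/
theorem exists_delete_nest (E : VCD n) (l m : ℕ)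
    (h : ∀ j < m, ∃ p q, E.Next p q ∧ ¬ E.Term q ∧
      ((p.val + j = l ∧ q.val = l + 1 + j) ∨ (q.val + j = l ∧ p.val = l + 1 + j))) :
    ∃ E' : VCD n, Relation.ReflTransGen Move E E' ∧
      ∃ f, E.Deletes E'.toCurveSystem f {x | l < x.val + m ∧ x.val < l + 1 + m} ∧
        (∀ x y, E.Next (f x) (f y) → E'.Next x y) ∧
        ∀ x, E'.Term x ↔ E.Term (f x) := by
  induction m with
  | zero =>
    refine ⟨E, .refl, RelEmbedding.refl _, ?_, fun _ _ h => h, fun _ => Iff.rfl⟩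
    convert E.deletes_empty
    ext x
    simp
  | succ m ih =>
    obtain ⟨E₁, hE₁, f, hf, hnext, hterm⟩ := ih fun j hj => h j (by omega)
    obtain ⟨p, q, hpq, hq, hval⟩ := h m (by omega)
    -- The next pair lies just outside the block of `2 * m` positions already deleted, so it
    -- survives and has become adjacent.
    obtain ⟨p, rfl⟩ := hf.exists_eq (p := p) (by simp; omega)
    obtain ⟨q, rfl⟩ := hf.exists_eq (p := q) (by simp; omega)
    have hpq₁ := hnext _ _ hpq
    have hq₁ : ¬ E₁.Term q := mt (hterm q).1 hq
    have key : ∀ x y : Fin E₁.numUpper, (f x).val + m = l → (f y).val = l + 1 + m →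
        x.val + 1 = y.val := by
      intro x y hx hy
      have h1 : x < y := f.lt_iff_lt.1 (Fin.lt_def.2 (by omega))
      by_contra hne
      have h2 : x.val < y.val := h1
      have h3 : f x < f ⟨x.val + 1, by omega⟩ := f.lt_iff_lt.2 (Fin.lt_def.2 (by simp))
      have h4 : f ⟨x.val + 1, by omega⟩ < f y :=
        f.lt_iff_lt.2 (Fin.lt_def.2 (by dsimp only; omega))
      have h5 := hf.not_mem ⟨x.val + 1, by omega⟩
      rw [Fin.lt_def] at h3 h4
      apply h5
      constructor <;> omega
    have hadj : Adj p q := by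
      rcases hval with ⟨h1, h2⟩ | ⟨h1, h2⟩
      exacts [Or.inl (key _ _ h1 h2), Or.inr (key _ _ h1 h2)]
    obtain ⟨E₂, g, hg⟩ := E₁.exists_deletes_moveSet hpq₁ hadj
    refine ⟨E₂, hE₁.tail ⟨p, q, hpq₁, hadj, g, hg⟩, g.trans f, ?_, ?_, ?_⟩
    · have h1 := hf.trans hg
      rw [moveSet_of_not_term hq₁, Set.image_pair] at h1
      convert h1 using 1
      ext x
      simp only [Set.mem_ofPred_eq, Set.mem_union, Set.mem_insert_iff, Set.mem_singleton_iff,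
        Fin.ext_iff]
      omega
    · intro x y hxy
      exact hg.next hpq₁ (hnext _ _ hxy)
    · intro x
      have hx : g x ≠ p := by
        have := hg.not_mem x
        rw [moveSet_of_not_term hq₁] at this
        exact fun h => this (Or.inl h)
      rw [hg.term_iff hpq₁ hx, hterm]
      rfl

end VCD

/-! ### Intervals spanned by arcs, and parallelity classes as nests -/

namespace CurveSystem

variable {n : ℕ} {E : CurveSystem n}

/-- The arc `α` is an over arc (`k = 0`) or an under arc (`k = 1`) whose endpoints are the
upper points at the positions `l < h`. -/
def Arc.Spans (α : E.Arc) (k l h : ℕ) : Prop :=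
  ∃ p q, α.Joins k p q ∧ l < h ∧ ((p.val = l ∧ q.val = h) ∨ (q.val = l ∧ p.val = h))

theorem Arc.Joins.exists_spans {α : E.Arc} {k : ℕ} {p q : Fin E.numUpper} (hα : α.Joins k p q) :
    ∃ l h, α.Spans k l h := by
  have hne : p.val ≠ q.val := fun h => hα.step.next.ne (Fin.ext h)
  rcases lt_or_gt_of_ne hne with h | h
  exacts [⟨p, q, p, q, hα, h, Or.inl ⟨rfl, rfl⟩⟩, ⟨q, p, p, q, hα, h, Or.inr ⟨rfl, rfl⟩⟩]

theorem Arc.Spans.lt {α : E.Arc} {k l h : ℕ} (hα : α.Spans k l h) : l < h := by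
  obtain ⟨p, q, -, hlt, -⟩ := hα
  exact hlt

theorem Arc.Joins.unique {α : E.Arc} {k k' : ℕ} {p q p' q' : Fin E.numUpper}
    (h : α.Joins k p q) (h' : α.Joins k' p' q') : k = k' ∧ p = p' ∧ q = q' :=
  ⟨h.parity.symm.trans h'.parity, Sum.inr.inj (h.src_eq.symm.trans h'.src_eq),
    Sum.inr.inj (h.tgt_eq.symm.trans h'.tgt_eq)⟩

theorem Arc.Spans.unique {α : E.Arc} {k k' l l' h h' : ℕ} (hα : α.Spans k l h)
    (hα' : α.Spans k' l' h') : k = k' ∧ l = l' ∧ h = h' := by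
  obtain ⟨p, q, h1, h2, h3⟩ := hα
  obtain ⟨p', q', h4, h5, h6⟩ := hα'
  obtain ⟨rfl, rfl, rfl⟩ := h1.unique h4
  omega

/-- Two different arcs that meet at an upper point are consecutive on a curve and so have different
types. -/
theorem Arc.Spans.eq_of_endpoint {α β : E.Arc} {k l l' h h' : ℕ} (hα : α.Spans k l h)
    (hβ : β.Spans k l' h') (he : l = l' ∨ l = h' ∨ h = l' ∨ h = h') : α = β := by
  obtain ⟨p, q, h1, h2, h3⟩ := hα
  obtain ⟨p', q', h4, h5, h6⟩ := hβ
  have hcases : p = p' ∨ p = q' ∨ q = p' ∨ q = q' := by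
    simp only [Fin.ext_iff]
    omega
  rcases hcases with rfl | rfl | rfl | rfl
  · obtain rfl := h1.step.next.right_unique h4.step.next
    exact h1.eq_of_tgt h4
  · exact (h4.step.not_consecutive h1.step).elim
  · exact (h1.step.not_consecutive h4.step).elim
  · exact h1.eq_of_tgt h4

theorem Arc.Spans.enclosesPoint_iff {α : E.Arc} {k l h : ℕ} (hα : α.Spans k l h)
    {x : Fin E.numUpper} : α.EnclosesPoint (Sum.inr x) ↔ l < x.val ∧ x.val < h := by
  obtain ⟨p, q, h1, h2, h3⟩ := hα
  rw [h1.enclosesPoint_iff]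
  unfold Btw
  omega

theorem Arc.Spans.enclosesArc_iff {α β : E.Arc} {k k' l l' h h' : ℕ} (hα : α.Spans k l h)
    (hβ : β.Spans k' l' h') : α.EnclosesArc β ↔ l < l' ∧ h' < h := by
  obtain ⟨p, q, h1, h2, h3⟩ := hβ
  unfold Arc.EnclosesArc
  rw [h1.src_eq, h1.tgt_eq, hα.enclosesPoint_iff, hα.enclosesPoint_iff]
  omega

theorem Arc.Spans.cross_iff {α β : E.Arc} {k l l' h h' : ℕ} (hα : α.Spans k l h)
    (hβ : β.Spans k l' h') :
    α.Cross β ↔ Xor (l < l' ∧ l' < h) (l < h' ∧ h' < h) := by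
  obtain ⟨p, q, h1, h2, h3⟩ := hα
  obtain ⟨p', q', h4, h5, h6⟩ := hβ
  rw [h1.cross_iff h4]
  unfold Xor Btw
  omega

theorem Arc.Spans.adjacent_iff {α : E.Arc} {k l h : ℕ} (hα : α.Spans k l h) :
    Adjacent α.src α.tgt ↔ h = l + 1 := by
  obtain ⟨p, q, h1, h2, h3⟩ := hα
  rw [h1.adjacent_iff]
  unfold Adj
  omega

theorem Arc.Spans.incident_iff {α : E.Arc} {k l h : ℕ} (hα : α.Spans k l h)
    {x : Fin E.numUpper} : α.Incident (Sum.inr x) ↔ x.val = l ∨ x.val = h := by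
  obtain ⟨p, q, h1, h2, h3⟩ := hα
  unfold Arc.Incident
  rw [h1.src_eq, h1.tgt_eq, Sum.inr.injEq, Sum.inr.injEq, Fin.ext_iff, Fin.ext_iff]
  omega

theorem Arc.Spans.isOver_iff {α : E.Arc} {k l h : ℕ} (hα : α.Spans k l h) :
    α.IsOver ↔ k = 0 := by
  obtain ⟨p, q, h1, h2, h3⟩ := hα
  rw [Arc.isOver_iff]
  constructor
  · rintro ⟨p', q', h4⟩
    exact (h1.unique h4).1
  · rintro rfl
    exact ⟨p, q, h1⟩

theorem Arc.Spans.isUnder_iff {α : E.Arc} {k l h : ℕ} (hα : α.Spans k l h) :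
    α.IsUnder ↔ k = 1 := by
  obtain ⟨p, q, h1, h2, h3⟩ := hα
  rw [Arc.isUnder_iff]
  constructor
  · rintro ⟨p', q', h4⟩
    exact (h1.unique h4).1
  · rintro rfl
    exact ⟨p, q, h1⟩

theorem Arc.Spans.lt_two {α : E.Arc} {k l h : ℕ} (hα : α.Spans k l h) : k < 2 := by
  obtain ⟨p, q, h1, -⟩ := hα
  exact h1.lt_two

theorem Arc.exists_spans {α : E.Arc} (h : α.IsOver ∨ α.IsUnder) : ∃ k l h, α.Spans k l h := by
  obtain ⟨k, p, q, hα⟩ := Arc.isOver_or_isUnder_iff.1 h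
  exact ⟨k, hα.exists_spans⟩

/-- For distinct arcs, which share no endpoint, the absence of crossings leaves only tight nesting.
The last case is degenerate: an arc with adjacent endpoints is related to itself by the matching
that exchanges them. -/
theorem Arc.Spans.parallelStep_iff {α β : E.Arc} {k k' l l' h h' : ℕ} (hα : α.Spans k l h)
    (hβ : β.Spans k' l' h') : α.ParallelStep β ↔ k = k' ∧
      ((l' = l + 1 ∧ h = h' + 1) ∨ (l = l' + 1 ∧ h' = h + 1) ∨ (α = β ∧ h = l + 1)) := by
  have hk := hα.lt_two
  have hk' := hβ.lt_two
  unfold Arc.ParallelStep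
  rw [hα.isOver_iff, hα.isUnder_iff, hβ.isOver_iff, hβ.isUnder_iff]
  by_cases hkk : k = k'
  · subst hkk
    rw [hα.cross_iff hβ]
    have hend := hα.eq_of_endpoint hβ
    have huniq : α = β → l = l' ∧ h = h' := by
      rintro rfl
      exact (hα.unique hβ).2
    obtain ⟨p, q, h1, h2, h3⟩ := hα
    obtain ⟨p', q', h4, h5, h6⟩ := hβ
    rw [h1.src_eq, h1.tgt_eq, h4.src_eq, h4.tgt_eq]
    simp only [adjacent_inr_iff]
    unfold Adj Xor
    by_cases hαβ : α = β
    · have := huniq hαβ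
      subst hαβ
      obtain ⟨-, rfl, rfl⟩ := h1.unique h4
      simp only [true_and]
      constructor <;> omega
    · have := mt hend hαβ
      simp only [hαβ, false_and, or_false, true_and]
      omega
  · simp only [hkk, false_and, iff_false]
    omega

theorem Arc.ParallelStep.symm {α β : E.Arc} (h : α.ParallelStep β) : β.ParallelStep α := by
  have h1 := h.1
  obtain ⟨k, l, h', hα⟩ := α.exists_spans (by tauto)
  obtain ⟨k', l', h'', hβ⟩ := β.exists_spans (by tauto)
  rw [hα.parallelStep_iff hβ] at h
  rw [hβ.parallelStep_iff hα]
  obtain ⟨rfl, h⟩ := h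
  refine ⟨rfl, ?_⟩
  rcases h with h | h | ⟨rfl, h⟩
  · exact Or.inr (Or.inl h)
  · exact Or.inl h
  · exact Or.inr (Or.inr ⟨rfl, by have := hα.unique hβ; omega⟩)

theorem Arc.Parallel.symm {α β : E.Arc} (h : α.Parallel β) : β.Parallel α := by
  induction h with
  | refl => exact .refl
  | tail _ h2 ih => exact .head h2.symm ih

theorem Arc.Parallel.exists_spans {α β : E.Arc} (hp : α.Parallel β) {k l h : ℕ}
    (hα : α.Spans k l h) : ∃ l' h', β.Spans k l' h' := by
  induction hp with
  | refl => exact ⟨l, h, hα⟩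
  | tail _ h2 ih =>
    obtain ⟨l', h', hβ⟩ := ih
    have h3 := h2.1
    obtain ⟨k', l'', h'', hγ⟩ := Arc.exists_spans (α := _) (by
      rcases h3 with h3 | h3
      exacts [Or.inl h3.2, Or.inr h3.2])
    obtain ⟨rfl, -⟩ := (hβ.parallelStep_iff hγ).1 h2
    exact ⟨_, _, hγ⟩

theorem mem_condensedArcs {A : Set E.Arc} (hA : A ∈ E.condensedArcs) {α : E.Arc} (hα : α ∈ A) :
    A = {β | α.Parallel β} := by
  obtain ⟨γ, rfl⟩ := hA
  have hα : γ.Parallel α := hα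
  ext β
  exact ⟨fun h => Relation.ReflTransGen.trans hα.symm h, fun h => Relation.ReflTransGen.trans hα h⟩

/-- The arc `β` spans the interval obtained from `{l, l + 1}` by adding `j` points on
either side. -/
def Arc.AtLevel (β : E.Arc) (k l j : ℕ) : Prop := ∃ l', l' + j = l ∧ β.Spans k l' (l + 1 + j)

theorem Arc.AtLevel.unique {β : E.Arc} {k l j j' : ℕ} (h : β.AtLevel k l j)
    (h' : β.AtLevel k l j') : j = j' := by
  obtain ⟨_, -, h⟩ := h
  obtain ⟨_, -, h'⟩ := h'
  have := h.unique h'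
  omega

theorem Arc.AtLevel.eq {β γ : E.Arc} {k l j : ℕ} (h : β.AtLevel k l j)
    (h' : γ.AtLevel k l j) : β = γ := by
  obtain ⟨_, -, h⟩ := h
  obtain ⟨_, -, h'⟩ := h'
  exact h.eq_of_endpoint h' (by omega)

theorem Arc.AtLevel.enclosesArc_iff {β γ : E.Arc} {k l j j' : ℕ} (h : β.AtLevel k l j)
    (h' : γ.AtLevel k l j') : β.EnclosesArc γ ↔ j' < j := by
  obtain ⟨_, h1, h⟩ := h
  obtain ⟨_, h1', h'⟩ := h'
  rw [h.enclosesArc_iff h']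
  omega

/-- A parallel step changes the level by at most one, so a chain from level `0` visits every level
below the one it reaches. -/
theorem Arc.Parallel.exists_atLevel {α β : E.Arc} {k l : ℕ} (hα : α.Spans k l (l + 1))
    (hp : α.Parallel β) :
    ∃ j, β.AtLevel k l j ∧ ∀ j' ≤ j, ∃ γ, α.Parallel γ ∧ γ.AtLevel k l j' := by
  induction hp with
  | refl =>
    refine ⟨0, ⟨l, rfl, hα⟩, fun j' hj' => ⟨α, .refl, ?_⟩⟩
    obtain rfl : j' = 0 := by omega
    exact ⟨l, rfl, hα⟩
  | @tail β γ h1 h2 ih =>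
    obtain ⟨j, hj, hjs⟩ := ih
    have hp : α.Parallel γ := Relation.ReflTransGen.tail h1 h2
    obtain ⟨l'', h'', hγ⟩ := hp.exists_spans hα
    have hj' := hj
    obtain ⟨l', hl', hβ⟩ := hj
    rcases ((hβ.parallelStep_iff hγ).1 h2).2 with h3 | h3 | ⟨rfl, -⟩
    · have := hγ.lt
      have hγ' : γ.AtLevel k l (j - 1) := ⟨l'', by omega, by
        rwa [show l + 1 + (j - 1) = h'' by omega]⟩
      exact ⟨j - 1, hγ', fun j' h4 => hjs j' (by omega)⟩
    · have hγ' : γ.AtLevel k l (j + 1) := ⟨l'', by omega, by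
        rwa [show l + 1 + (j + 1) = h'' by omega]⟩
      refine ⟨j + 1, hγ', fun j' h4 => ?_⟩
      rcases Nat.lt_or_ge j j' with h5 | h5
      · obtain rfl : j' = j + 1 := by omega
        exact ⟨γ, hp, hγ'⟩
      · exact hjs j' h5
    · exact ⟨j, hj', hjs⟩

end CurveSystem

/-! ### Deleting the inner levels of a condensed arc by simplifying moves -/

namespace VCD

variable {n : ℕ}

theorem exists_delete_levels (E : VCD n) {k l m : ℕ} {B : Set E.Arc}
    (hB : ∀ β ∈ B, ∃ j < m, β.AtLevel k l j) (hm : ∀ j < m, ∃ β ∈ B, β.AtLevel k l j)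
    (hterm : ∀ p ∈ incidentPoints B, ¬ E.IsTerminal p) :
    ∃ E' : VCD n, Relation.ReflTransGen Move E E' ∧ IsDeletion E E' (incidentPoints B) := by
  obtain ⟨E', hE', f, hf, -⟩ := E.exists_delete_nest l m (by
    intro j hj
    obtain ⟨β, hβB, l', hl', p, q, hpq, hlt, hval⟩ := hm j hj
    refine ⟨p, q, hpq.step.next, hterm (Sum.inr q) ⟨β, hβB, Or.inr hpq.tgt_eq.symm⟩, ?_⟩
    omega)
  refine ⟨E', hE', isDeletion_iff.2 ⟨f, ?_⟩⟩
  convert hf using 1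
  ext x
  simp only [incidentPoints, Set.mem_ofPred_eq]
  constructor
  · rintro ⟨β, hβ, hx⟩
    obtain ⟨j, hj, l', hl', hs⟩ := hB β hβ
    rw [hs.incident_iff] at hx
    omega
  · rintro ⟨h1, h2⟩
    rcases Nat.lt_or_ge l x with h3 | h3
    · obtain ⟨β, hβ, l', hl', hs⟩ := hm (x - (l + 1)) (by omega)
      exact ⟨β, hβ, hs.incident_iff.2 (by omega)⟩
    · obtain ⟨β, hβ, l', hl', hs⟩ := hm (l - x) (by omega)
      exact ⟨β, hβ, hs.incident_iff.2 (by omega)⟩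

theorem exists_delete_condensedArc (E : VCD n) {α : E.Arc} {k l : ℕ}
    (hα : α.Spans k l (l + 1))
    (hterm : ∀ p ∈ incidentPoints {β | α.Parallel β}, ¬ E.IsTerminal p) :
    ∃ E' : VCD n, Relation.ReflTransGen Move E E' ∧
      IsDeletion E E' (incidentPoints {β | α.Parallel β}) := by
  classical
  have hex : ∃ j, ¬ ∃ β : E.Arc, α.Parallel β ∧ β.AtLevel k l j := by
    -- An arc at level `l + 1` would need an endpoint to the left of position `0`. The first empty
    -- level is the number of arcs in the class.
    refine ⟨l + 1, ?_⟩
    rintro ⟨β, -, l', hl', -⟩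
    omega
  refine E.exists_delete_levels (k := k) (l := l) (m := Nat.find hex) ?_ ?_ hterm
  · intro β hβ
    obtain ⟨j, hj, hjs⟩ := Arc.Parallel.exists_atLevel hα hβ
    refine ⟨j, ?_, hj⟩
    by_contra hlt
    exact Nat.find_spec hex (hjs _ (by omega))
  · intro j hj
    exact not_not.1 (Nat.find_min hex hj)

/-- The arcs of the class inside `β` fill the levels below that of `β`, and none of them has a
terminal endpoint, since `β` is the innermost arc with one. -/
theorem exists_delete_inside (E : VCD n) {α β : E.Arc} {k l : ℕ} {A : Set E.Arc}
    (hα : α.Spans k l (l + 1)) (hA : A = {β | α.Parallel β})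
    (hβ : IsInnermost {γ ∈ A | ∃ p, γ.Incident p ∧ E.IsTerminal p} β) :
    ∃ E' : VCD n, Relation.ReflTransGen Move E E' ∧
      IsDeletion E E' (incidentPoints {γ ∈ A | β.EnclosesArc γ}) := by
  subst hA
  obtain ⟨⟨hβA, -⟩, hinn⟩ := hβ
  obtain ⟨m, hm, hms⟩ := Arc.Parallel.exists_atLevel hα hβA
  refine E.exists_delete_levels (k := k) (l := l) (m := m) ?_ ?_ ?_
  · rintro γ ⟨hγ, hβγ⟩
    obtain ⟨j, hj, -⟩ := Arc.Parallel.exists_atLevel hα hγ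
    exact ⟨j, (hm.enclosesArc_iff hj).1 hβγ, hj⟩
  · intro j hj
    obtain ⟨γ, hγ, hγj⟩ := hms j hj.le
    exact ⟨γ, ⟨hγ, (hm.enclosesArc_iff hγj).2 hj⟩, hγj⟩
  · rintro p ⟨γ, ⟨hγ, hβγ⟩, hp⟩ ht
    obtain ⟨j, hj, -⟩ := Arc.Parallel.exists_atLevel hα hγ
    have h1 := (hm.enclosesArc_iff hj).1 hβγ
    have hne : γ ≠ β := by
      rintro rfl
      have := hm.unique hj
      omega
    have h2 := (hj.enclosesArc_iff hm).1 (hinn γ ⟨hγ, p, hp, ht⟩ hne)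
    omega

theorem exists_isInnermost_terminal (E : VCD n) {α : E.Arc} {k l : ℕ} {A : Set E.Arc}
    (hα : α.Spans k l (l + 1)) (hA : A = {β | α.Parallel β})
    (h : ∃ p ∈ incidentPoints A, E.IsTerminal p) :
    ∃ β, IsInnermost {γ ∈ A | ∃ p, γ.Incident p ∧ E.IsTerminal p} β := by
  classical
  subst hA
  have hex : ∃ j, ∃ γ : E.Arc, (α.Parallel γ ∧ ∃ p, γ.Incident p ∧ E.IsTerminal p) ∧
      γ.AtLevel k l j := by
    obtain ⟨p, ⟨γ, hγ, hp⟩, ht⟩ := h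
    obtain ⟨j, hj, -⟩ := Arc.Parallel.exists_atLevel hα hγ
    exact ⟨j, γ, ⟨hγ, p, hp, ht⟩, hj⟩
  obtain ⟨β, hβ, hβj⟩ := Nat.find_spec hex
  refine ⟨β, hβ, ?_⟩
  rintro γ hγ hne
  obtain ⟨j, hj, -⟩ := Arc.Parallel.exists_atLevel hα hγ.1
  rw [hj.enclosesArc_iff hβj]
  have h1 : Nat.find hex ≤ j := Nat.find_min' hex ⟨γ, hγ, hj⟩
  refine lt_of_le_of_ne h1 ?_
  intro heq
  rw [heq] at hβj
  exact hne (hj.eq hβj)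

theorem isInnermost_of_spans (E : VCD n) {α : E.Arc} {k l : ℕ} (hα : α.Spans k l (l + 1)) :
    IsInnermost {β | α.Parallel β} α := by
  refine ⟨Relation.ReflTransGen.refl, fun β hβ hne => ?_⟩
  obtain ⟨j, hj, -⟩ := Arc.Parallel.exists_atLevel hα hβ
  have h0 : α.AtLevel k l 0 := ⟨l, rfl, hα⟩
  rw [hj.enclosesArc_iff h0]
  refine Nat.pos_of_ne_zero ?_
  rintro rfl
  exact hne (hj.eq h0)

theorem eq_of_isDeletion {E E₁ E₂ : VCD n} {S : Set E.Point} (h₁ : IsDeletion E E₁ S)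
    (h₂ : IsDeletion E E₂ S) : E₁ = E₂ := by
  obtain ⟨f, hf⟩ := isDeletion_iff.1 h₁
  obtain ⟨g, hg⟩ := isDeletion_iff.1 h₂
  exact eq_of_deletes hf hg

end VCD

/-! ### Simplified condensed diagrams: characterization and uniqueness -/

namespace CVCD

variable {n : ℕ}

theorem eq_of_underlying_eq {D D' : CVCD n} (h : D.underlying = D'.underlying) : D = D' := by
  obtain ⟨E, t, ht⟩ := D
  obtain ⟨E', t', ht'⟩ := D'
  dsimp only at h
  subst h
  subst ht ht'
  rfl

theorem IsOverOrUnder.arc {E : VCD n} {A : Set E.Arc} (h : IsOverOrUnder A) {α : E.Arc}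
    (hα : α ∈ A) : α.IsOver ∨ α.IsUnder := by
  rcases h with h | h
  exacts [Or.inl (h α hα), Or.inr (h α hα)]

/-- The source of an arc is never terminal, so a condensed T-move is a T-move. A condensed B-move
removes inner levels of a nest that have no terminal endpoints. -/
theorem SimplifyingMove.reflTransGen {D D' : CVCD n} (h : D.SimplifyingMove D') :
    Relation.ReflTransGen VCD.Move D.underlying D'.underlying := by
  rcases h with ⟨A, hA, hou, α, hα, hadj, p, hp, ht, hdel⟩ |
    ⟨A, hA, hou, α, hα, hadj, hs, ht, hdel⟩
  · apply Relation.ReflTransGen.single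
    rw [VCD.move_iff]
    obtain ⟨k, p', q', hj⟩ := Arc.isOver_or_isUnder_iff.1 (hou.arc hα.1)
    rcases hp with rfl | rfl
    · rw [hj.src_eq] at ht
      exact absurd ht hj.step.next.not_term
    · exact Or.inl ⟨α, hou.arc hα.1, hadj, ht, hdel⟩
  · obtain ⟨k, l, h, hspan⟩ := Arc.exists_spans (hou.arc hα.1)
    obtain rfl := hspan.adjacent_iff.1 hadj
    have hA' := mem_condensedArcs hA hα.1
    rcases hdel with ⟨hterm, hdel⟩ | ⟨β, hβ, hdel⟩
    · subst hA'
      obtain ⟨E', hE', hdel'⟩ := D.underlying.exists_delete_condensedArc hspan hterm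
      rwa [VCD.eq_of_isDeletion hdel hdel']
    · obtain ⟨E', hE', hdel'⟩ := D.underlying.exists_delete_inside hspan hA' hβ
      rwa [VCD.eq_of_isDeletion hdel hdel']

/-- The innermost arc used by a condensed move already permits a simplifying move. Conversely, an
arc with adjacent endpoints is innermost in its class, and the terminal endpoints in the class
decide which condensed move applies. -/
theorem simplified_iff_no_move (D : CVCD n) : D.Simplified ↔
    ¬ ∃ D' : CVCD n, D.SimplifyingCondensedT D' ∨ D.SimplifyingCondensedB D' := by
  constructor
  · intro h
    have key : ∀ A : Set D.underlying.Arc, IsOverOrUnder A → ∀ α, IsInnermost A α →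
        ¬ Adjacent α.src α.tgt := by
      intro A hou α hα hadj
      obtain ⟨k, p, q, hj⟩ := Arc.isOver_or_isUnder_iff.1 (hou.arc hα.1)
      exact VCD.simplified_iff.1 h p q hj.step.next (hj.adjacent_iff.1 hadj)
    rintro ⟨D', ⟨A, -, hou, α, hα, hadj, -⟩ | ⟨A, -, hou, α, hα, hadj, -⟩⟩
    exacts [key A hou α hα hadj, key A hou α hα hadj]
  · intro h hex
    obtain ⟨E', hE'⟩ := hex
    apply h
    have hall : ∃ α : D.underlying.Arc, (α.IsOver ∨ α.IsUnder) ∧ Adjacent α.src α.tgt ∧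
        (D.underlying.IsTerminal α.tgt → ∃ E'', VCD.IsDeletion D.underlying E'' {α.tgt}) := by
      rcases hE' with ⟨α, h1, h2, -, h4⟩ | ⟨α, h1, h2, h3, -⟩
      exacts [⟨α, h1, h2, fun _ => ⟨E', h4⟩⟩, ⟨α, h1, h2, fun h => absurd h h3⟩]
    obtain ⟨α, h1, h2, h3⟩ := hall
    obtain ⟨k, l, h, hspan⟩ := Arc.exists_spans h1
    obtain rfl := hspan.adjacent_iff.1 h2
    have hou : IsOverOrUnder {β | α.Parallel β} := by
      rcases h1 with h1 | h1
      · left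
        intro β hβ
        obtain ⟨_, _, hs⟩ := Arc.Parallel.exists_spans hβ hspan
        exact hs.isOver_iff.2 (hspan.isOver_iff.1 h1)
      · right
        intro β hβ
        obtain ⟨_, _, hs⟩ := Arc.Parallel.exists_spans hβ hspan
        exact hs.isUnder_iff.2 (hspan.isUnder_iff.1 h1)
    have hinn := D.underlying.isInnermost_of_spans hspan
    by_cases ht : D.underlying.IsTerminal α.tgt
    · obtain ⟨E'', hE''⟩ := h3 ht
      exact ⟨⟨E'', _, rfl⟩, Or.inl ⟨_, ⟨α, rfl⟩, hou, α, hinn, h2, α.tgt, Or.inr rfl, ht, hE''⟩⟩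
    · have hs : ¬ D.underlying.IsTerminal α.src := by
        obtain ⟨k, p, q, hj⟩ := Arc.isOver_or_isUnder_iff.1 h1
        rw [hj.src_eq]
        exact hj.step.next.not_term
      by_cases hall : ∀ p ∈ incidentPoints {β | α.Parallel β}, ¬ D.underlying.IsTerminal p
      · obtain ⟨E'', -, hE''⟩ := D.underlying.exists_delete_condensedArc hspan hall
        exact ⟨⟨E'', _, rfl⟩,
          Or.inr ⟨_, ⟨α, rfl⟩, hou, α, hinn, h2, hs, ht, Or.inl ⟨hall, hE''⟩⟩⟩
      · push Not at hall
        obtain ⟨β, hβ⟩ := D.underlying.exists_isInnermost_terminal hspan rfl hall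
        obtain ⟨E'', -, hE''⟩ := D.underlying.exists_delete_inside hspan rfl hβ
        exact ⟨⟨E'', _, rfl⟩,
          Or.inr ⟨_, ⟨α, rfl⟩, hou, α, hinn, h2, hs, ht, Or.inr ⟨β, hβ, hE''⟩⟩⟩

theorem eq_of_related {D₁ D₂ : CVCD n} (h₁ : D₁.Simplified) (h₂ : D₂.Simplified)
    (h : D₁.Related D₂) : D₁ = D₂ := by
  have hgen : Relation.EqvGen (Relation.ReflTransGen VCD.Move) D₁.underlying D₂.underlying := by
    clear h₁ h₂
    induction h with
    | rel D D' h => exact .rel _ _ h.reflTransGen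
    | refl D => exact .refl _
    | symm D D' _ ih => exact .symm _ _ ih
    | trans D D' D'' _ _ ih₁ ih₂ => exact .trans _ _ _ ih₁ ih₂
  obtain ⟨E, hE₁, hE₂⟩ := VCD.join_of_eqvGen hgen
  exact eq_of_underlying_eq
    ((VCD.Simplified.eq_of_reflTransGen h₁ hE₁).trans
      (VCD.Simplified.eq_of_reflTransGen h₂ hE₂).symm)

end CVCD

/-! ### Counting laminar families -/

/-- A laminar family of nonempty subsets of a finite set `X` has at most `2 * #X - 1` members. -/
theorem Finset.card_le_of_laminar {ι : Type*} [DecidableEq ι] (X : Finset ι) :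
    ∀ F : Finset (Finset ι), ∅ ∉ F → (∀ A ∈ F, A ⊆ X) →
      (∀ A ∈ F, ∀ B ∈ F, A ⊆ B ∨ B ⊆ A ∨ Disjoint A B) → F.card ≤ 2 * X.card - 1 := by
  induction X using Finset.induction_on with
  | empty =>
    intro F h0 hX _
    have : F = ∅ := by
      rw [Finset.eq_empty_iff_forall_notMem]
      intro A hA
      have := hX A hA
      rw [Finset.subset_empty] at this
      exact h0 (this ▸ hA)
    simp [this]
  | insert x X hx ih =>
    intro F h0 hX hlam
    rw [Finset.card_insert_of_notMem hx]
    -- For empty `X` the bound `2 * 0 - 1` truncates to `0`, and the induction step would give `2`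
    -- instead of `1`.
    rcases X.eq_empty_or_nonempty with rfl | hne
    · have : F ⊆ {{x}} := by
        intro A hA
        rw [Finset.mem_singleton]
        have h1 := hX A hA
        rcases Finset.subset_singleton_iff.1 h1 with h2 | h2
        · exact absurd (h2 ▸ hA) h0
        · exact h2
      simpa using Finset.card_le_card this
    have hcard := hne.card_pos
    -- Erasing `x` preserves laminarity and loses at most two members: `{x}` becomes empty, and at
    -- most one pair `A`, `insert x A` is identified.
    let F' : Finset (Finset ι) := (F.image fun A => A.erase x).erase ∅
    have hF' : F'.card ≤ 2 * X.card - 1 := by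
      apply ih
      · simp [F']
      · intro A hA
        simp only [F', Finset.mem_erase, Finset.mem_image] at hA
        obtain ⟨-, B, hB, rfl⟩ := hA
        intro y hy
        rw [Finset.mem_erase] at hy
        exact (Finset.mem_insert.1 (hX B hB hy.2)).resolve_left hy.1
      · intro A hA B hB
        simp only [F', Finset.mem_erase, Finset.mem_image] at hA hB
        obtain ⟨-, A, hA, rfl⟩ := hA
        obtain ⟨-, B, hB, rfl⟩ := hB
        rcases hlam A hA B hB with h | h | h
        · exact Or.inl (Finset.erase_subset_erase x h)
        · exact Or.inr (Or.inl (Finset.erase_subset_erase x h))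
        · exact Or.inr (Or.inr (h.mono (Finset.erase_subset _ _) (Finset.erase_subset _ _)))
    -- Applied both ways, this shows that only one pair is identified. It rests on the fact that
    -- `insert x A` and `insert x B` share `x` and are therefore comparable.
    have huniq : ∀ A B, x ∉ A → x ∉ B → A ∈ F → B ∈ F → insert x A ∈ F → insert x B ∈ F →
        A ⊆ B := by
      intro A B hxA hxB hA hB hA' hB'
      rcases hlam A hA _ hB' with h | h | h
      · intro y hy
        exact (Finset.mem_insert.1 (h hy)).resolve_left (by rintro rfl; exact hxA hy)
      · exact absurd (h (Finset.mem_insert_self x B)) hxA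
      · rcases hlam _ hA' B hB with h' | h' | h'
        · exact absurd (h' (Finset.mem_insert_self x A)) hxB
        · have hBA : B ⊆ A := fun y hy =>
            (Finset.mem_insert.1 (h' hy)).resolve_left (by rintro rfl; exact hxB hy)
          obtain ⟨b, hb⟩ := Finset.nonempty_iff_ne_empty.2 (fun e : B = ∅ => h0 (e ▸ hB))
          exact absurd (Finset.mem_insert_of_mem hb) (Finset.disjoint_left.1 h (hBA hb))
        · have hsub : Disjoint A B := h'.mono_left (Finset.subset_insert x A)
          rcases hlam _ hA' _ hB' with h'' | h'' | h''
          · exact fun y hy => absurd (h'' (Finset.mem_insert_of_mem hy))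
              (Finset.disjoint_left.1 h hy)
          · obtain ⟨b, hb⟩ := Finset.nonempty_iff_ne_empty.2 (fun e : B = ∅ => h0 (e ▸ hB))
            exact absurd hb (Finset.disjoint_left.1 h' (h'' (Finset.mem_insert_of_mem hb)))
          · exact absurd (Finset.mem_insert_self x B)
              (Finset.disjoint_left.1 h'' (Finset.mem_insert_self x A))
    obtain ⟨C, hC⟩ : ∃ C : Finset ι, ∀ A, x ∉ A → A ∈ F → insert x A ∈ F → insert x A = C := by
      by_cases hex : ∃ A, x ∉ A ∧ A ∈ F ∧ insert x A ∈ F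
      · obtain ⟨A, h1, h2, h3⟩ := hex
        refine ⟨insert x A, fun B h4 h5 h6 => ?_⟩
        rw [(huniq A B h1 h4 h2 h5 h3 h6).antisymm (huniq B A h4 h1 h5 h2 h6 h3)]
      · exact ⟨∅, fun A h1 h2 h3 => absurd ⟨A, h1, h2, h3⟩ hex⟩
    have hle : ((F.erase {x}).erase C).card ≤ F'.card := by
      apply Finset.card_le_card_of_injOn fun A => A.erase x
      · intro A hA
        simp only [Finset.coe_erase, Set.mem_sdiff, Finset.mem_coe, Set.mem_singleton_iff] at hA
        simp only [F', Finset.coe_erase, Finset.coe_image, Set.mem_sdiff, Set.mem_image,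
          Finset.mem_coe, Set.mem_singleton_iff]
        refine ⟨⟨A, hA.1.1, rfl⟩, fun h => ?_⟩
        rcases (Finset.erase_eq_empty_iff A x).1 h with h | h
        · exact h0 (h ▸ hA.1.1)
        · exact hA.1.2 h
      · have key : ∀ A B, A ∈ F → B ∈ F → B ≠ C → A.erase x = B.erase x → x ∉ A → x ∉ B := by
          intro A B hA hB hBC hAB hxA hxB
          rw [Finset.erase_eq_of_notMem hxA] at hAB
          subst hAB
          have := Finset.insert_erase hxB
          exact hBC (this ▸ hC _ hxA hA (this.symm ▸ hB))
        intro A hA B hB hAB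
        simp only [Finset.coe_erase, Set.mem_sdiff, Finset.mem_coe, Set.mem_singleton_iff] at hA hB
        dsimp only at hAB
        by_cases hxA : x ∈ A
        · have hxB : x ∈ B := by
            by_contra hxB
            exact key B A hB.1.1 hA.1.1 hA.2 hAB.symm hxB hxA
          rw [← Finset.insert_erase hxA, hAB, Finset.insert_erase hxB]
        · have hxB := key A B hA.1.1 hB.1.1 hB.2 hAB hxA
          rwa [Finset.erase_eq_of_notMem hxA, Finset.erase_eq_of_notMem hxB] at hAB
    have h1 := Finset.pred_card_le_card_erase (s := F) (a := {x})
    have h2 := Finset.pred_card_le_card_erase (s := F.erase {x}) (a := C)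
    omega

/-! ### Planar families of arcs and the terminal points they enclose -/

namespace CurveSystem

variable {n : ℕ} {E : CurveSystem n}

theorem Arc.Spans.lt_numUpper {α : E.Arc} {k l h : ℕ} (hα : α.Spans k l h) : h < E.numUpper := by
  obtain ⟨p, q, -, -, hpq⟩ := hα
  omega

/-- A set of arcs of the same type that are pairwise disjoint and have no adjacent endpoints, such
that every point enclosed by one of them is terminal or lies on one of them. -/
structure IsPlanar (G : Set E.Arc) (k : ℕ) : Prop where
  exists_spans : ∀ α ∈ G, ∃ l h, α.Spans k l h
  not_spans_succ : ∀ α ∈ G, ∀ l, ¬ α.Spans k l (l + 1)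
  not_cross : ∀ α ∈ G, ∀ β ∈ G, ¬ α.Cross β
  exists_incident : ∀ α ∈ G, ∀ x : Fin E.numUpper, α.EnclosesPoint (Sum.inr x) → ¬ E.Term x →
    ∃ γ ∈ G, γ.Incident (Sum.inr x)

namespace IsPlanar

variable {G : Set E.Arc} {k : ℕ}

theorem nested_or_disjoint (hG : IsPlanar G k) {α β : E.Arc} (hα : α ∈ G) (hβ : β ∈ G)
    (hne : α ≠ β) {l h l' h' : ℕ} (hs : α.Spans k l h) (hs' : β.Spans k l' h') :
    (l < l' ∧ h' < h) ∨ (l' < l ∧ h < h') ∨ h < l' ∨ h' < l := by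
  have h1 := hG.not_cross α hα β hβ
  rw [hs.cross_iff hs'] at h1
  have h2 := mt (hs.eq_of_endpoint hs') hne
  have h3 := hs.lt
  have h4 := hs'.lt
  unfold Xor at h1
  omega

theorem exists_spans_of_enclosed (hG : IsPlanar G k) {α : E.Arc} (hα : α ∈ G) {l h : ℕ}
    (hs : α.Spans k l h) {x : Fin E.numUpper} (h1 : l < x.val) (h2 : x.val < h)
    (hx : ¬ E.Term x) :
    ∃ γ ∈ G, ∃ l' h', γ.Spans k l' h' ∧ (x.val = l' ∨ x.val = h') ∧ l < l' ∧ h' < h := by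
  obtain ⟨γ, hγ, hinc⟩ := hG.exists_incident α hα x (hs.enclosesPoint_iff.2 ⟨h1, h2⟩) hx
  obtain ⟨l', h', hs'⟩ := hG.exists_spans γ hγ
  rw [hs'.incident_iff] at hinc
  have hne : α ≠ γ := by
    rintro rfl
    have := hs.unique hs'
    omega
  have := hG.nested_or_disjoint hα hγ hne hs hs'
  have := hs'.lt
  exact ⟨γ, hγ, l', h', hs', hinc, by omega⟩

/-- The position `l + 1` is enclosed. If its point is not terminal, it lies on an arc of `G`
strictly inside `α`, so one can descend; `d` bounds the length. -/
theorem exists_term (hG : IsPlanar G k) : ∀ d : ℕ, ∀ α ∈ G, ∀ l h : ℕ, α.Spans k l h →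
    h - l ≤ d → ∃ t, E.Term t ∧ l < t.val ∧ t.val < h := by
  intro d
  induction d with
  | zero =>
    intro α hα l h hs hd
    have := hs.lt
    omega
  | succ d ih =>
    intro α hα l h hs hd
    have h1 := hs.lt
    have h2 := hs.lt_numUpper
    have h3 : h ≠ l + 1 := by
      rintro rfl
      exact hG.not_spans_succ α hα l hs
    by_cases hx : E.Term ⟨l + 1, by omega⟩
    · exact ⟨_, hx, by simp, by dsimp only; omega⟩
    · obtain ⟨γ, hγ, l', h', hs', hinc, h4, h5⟩ :=
        hG.exists_spans_of_enclosed hα hs (by simp) (by dsimp only; omega) hx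
      obtain ⟨t, ht, h6, h7⟩ := ih γ hγ l' h' hs' (by omega)
      exact ⟨t, ht, by omega, by omega⟩

/-- A point strictly between the nested arcs `α` and `β` lies on some `γ` in `G`. A terminal point
inside `γ` is also inside `β`, so `γ` and `β` are nested, and `γ` is the outer one. Hence `γ` splits
the gap into two smaller gaps. Without such a point, `α` and `β` are one parallel step apart. -/
theorem parallel_of_term (hG : IsPlanar G k) : ∀ d : ℕ, ∀ α ∈ G, ∀ β ∈ G, ∀ l h l' h' : ℕ,
    α.Spans k l h → β.Spans k l' h' → l < l' → h' < h → (l' - l) + (h - h') ≤ d →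
    (∀ t, E.Term t → l < t.val → t.val < h → l' < t.val ∧ t.val < h') → α.Parallel β := by
  intro d
  induction d with
  | zero => intros; omega
  | succ d ih =>
    intro α hα β hβ l h l' h' hs hs' hl hh hd ht
    have h1 := hs.lt
    have h2 := hs.lt_numUpper
    have h3 := hs'.lt
    have between : ∀ x : Fin E.numUpper, l < x.val → x.val < h → (x.val < l' ∨ h' < x.val) →
        α.Parallel β := by
      intro x hlx hxh hx
      obtain ⟨γ, hγ, a, b, hsγ, hinc, ha, hb⟩ := hG.exists_spans_of_enclosed hα hs hlx hxh
        (fun hterm => by have := ht x hterm hlx hxh; omega)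
      have hlt := hsγ.lt
      obtain ⟨t, hterm, ht1, ht2⟩ := hG.exists_term _ γ hγ a b hsγ le_rfl
      have ht3 := ht t hterm (by omega) (by omega)
      have hne : γ ≠ β := by
        rintro rfl
        have := hsγ.unique hs'
        omega
      have h4 := hG.nested_or_disjoint hγ hβ hne hsγ hs'
      refine Relation.ReflTransGen.trans (b := γ) ?_ ?_
      · exact ih α hα γ hγ l h a b hs hsγ ha hb (by omega) fun t h5 h6 h7 => by
          have := ht t h5 h6 h7
          omega
      · exact ih γ hγ β hβ a b l' h' hsγ hs' (by omega) (by omega) (by omega)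
          fun t h5 h6 h7 => ht t h5 (by omega) (by omega)
    by_cases h4 : l' = l + 1
    · by_cases h5 : h = h' + 1
      · exact Relation.ReflTransGen.single ((hs.parallelStep_iff hs').2 ⟨rfl, Or.inl ⟨h4, h5⟩⟩)
      · exact between ⟨h' + 1, by omega⟩ (by dsimp only; omega) (by dsimp only; omega)
          (by dsimp only; omega)
    · exact between ⟨l + 1, by omega⟩ (by dsimp only; omega) (by dsimp only; omega)
        (by dsimp only; omega)

/-- The sets `M` of curves whose terminal points are enclosed are nonempty by `exists_term`, laminar
by the absence of crossings, and separate classes by `parallel_of_term`. -/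
theorem ncard_condensedArcs_le (hG : IsPlanar G k) :
    {A ∈ E.condensedArcs | ∀ α ∈ A, α ∈ G}.ncard ≤ 2 * n - 1 := by
  classical
  set C : Set (Set E.Arc) := {A ∈ E.condensedArcs | ∀ α ∈ A, α ∈ G}
  let last : Fin n → Fin E.numUpper := fun i => (E.curve i).getLast (E.curve_ne_nil i)
  let M : E.Arc → Finset (Fin n) := fun α =>
    Finset.univ.filter fun i => α.EnclosesPoint (Sum.inr (last i))
  have hM : ∀ α k l h, α.Spans k l h → ∀ i, i ∈ M α ↔ l < (last i).val ∧ (last i).val < h := by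
    intro α k l h hs i
    simp only [M, Finset.mem_filter, Finset.mem_univ, true_and]
    exact hs.enclosesPoint_iff
  have hterm : ∀ t, E.Term t ↔ ∃ i, t = last i := by
    intro t
    simp [Term, IsTerminal, last]
  have hrep : ∀ A : C, ∃ α, α ∈ A.1 := by
    rintro ⟨_, ⟨α, rfl⟩, -⟩
    exact ⟨α, Relation.ReflTransGen.refl⟩
  choose rep hrep using hrep
  have hrepG : ∀ A : C, rep A ∈ G := fun A => A.2.2 _ (hrep A)
  have hlam : ∀ α ∈ G, ∀ β ∈ G, M α ⊆ M β ∨ M β ⊆ M α ∨ Disjoint (M α) (M β) := by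
    intro α hα β hβ
    by_cases hne : α = β
    · exact Or.inl (by rw [hne])
    obtain ⟨l, h, hs⟩ := hG.exists_spans α hα
    obtain ⟨l', h', hs'⟩ := hG.exists_spans β hβ
    have hα' := hM α k l h hs
    have hβ' := hM β k l' h' hs'
    rcases hG.nested_or_disjoint hα hβ hne hs hs' with h1 | h1 | h1
    · refine Or.inr (Or.inl fun i hi => ?_)
      rw [hβ'] at hi
      rw [hα']
      omega
    · refine Or.inl fun i hi => ?_
      rw [hα'] at hi
      rw [hβ']
      omega
    · refine Or.inr (Or.inr (Finset.disjoint_left.2 fun i hi => ?_))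
      rw [hα'] at hi
      rw [hβ']
      omega
  have hnonempty : ∀ α ∈ G, (M α).Nonempty := by
    intro α hα
    obtain ⟨l, h, hs⟩ := hG.exists_spans α hα
    obtain ⟨t, ht, h1, h2⟩ := hG.exists_term _ α hα l h hs le_rfl
    obtain ⟨i, rfl⟩ := (hterm t).1 ht
    exact ⟨i, (hM α k l h hs i).2 ⟨h1, h2⟩⟩
  have hpar : ∀ α ∈ G, ∀ β ∈ G, M α = M β → α.Parallel β := by
    intro α hα β hβ hαβ
    by_cases hne : α = β
    · rw [hne]
      exact Relation.ReflTransGen.refl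
    obtain ⟨l, h, hs⟩ := hG.exists_spans α hα
    obtain ⟨l', h', hs'⟩ := hG.exists_spans β hβ
    have hiff : ∀ t, E.Term t → (l < t.val ∧ t.val < h ↔ l' < t.val ∧ t.val < h') := by
      intro t ht
      obtain ⟨i, rfl⟩ := (hterm t).1 ht
      rw [← hM α k l h hs, ← hM β k l' h' hs', hαβ]
    rcases hG.nested_or_disjoint hα hβ hne hs hs' with h1 | h1 | h1
    · exact hG.parallel_of_term _ α hα β hβ l h l' h' hs hs' h1.1 h1.2 le_rfl
        fun t ht h2 h3 => (hiff t ht).1 ⟨h2, h3⟩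
    · exact (hG.parallel_of_term _ β hβ α hα l' h' l h hs' hs h1.1 h1.2 le_rfl
        fun t ht h2 h3 => (hiff t ht).2 ⟨h2, h3⟩).symm
    · obtain ⟨t, ht, h2, h3⟩ := hG.exists_term _ α hα l h hs le_rfl
      have := (hiff t ht).1 ⟨h2, h3⟩
      omega
  have hinj : Function.Injective fun A : C => M (rep A) := by
    intro A B hAB
    have h1 := hpar _ (hrepG A) _ (hrepG B) hAB
    apply Subtype.ext
    have h2 : rep B ∈ A.1 := by
      rw [mem_condensedArcs A.2.1 (hrep A)]
      exact h1
    rw [mem_condensedArcs A.2.1 h2, mem_condensedArcs B.2.1 (hrep B)]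
  have hfin : Fintype C := Fintype.ofFinite C
  have hcard : C.ncard = (Finset.univ.image fun A : C => M (rep A)).card := by
    rw [Finset.card_image_of_injective _ hinj, Finset.card_univ, ← Nat.card_eq_fintype_card]
    rfl
  have hbound := Finset.card_le_of_laminar (Finset.univ : Finset (Fin n))
    (Finset.univ.image fun A : C => M (rep A)) ?_ (fun A _ => Finset.subset_univ A) ?_
  · rw [hcard]
    rwa [Finset.card_fin] at hbound
  · intro h
    obtain ⟨A, -, hA⟩ := Finset.mem_image.1 h
    exact (hnonempty _ (hrepG A)).ne_empty hA
  · intro A hA B hB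
    obtain ⟨A, -, rfl⟩ := Finset.mem_image.1 hA
    obtain ⟨B, -, rfl⟩ := Finset.mem_image.1 hB
    exact hlam _ (hrepG A) _ (hrepG B)

end IsPlanar

/-! ### Over arcs and free under arcs as planar families -/

theorem exists_step_of_not_term {k : ℕ} (hk : k < 2) {x : Fin E.numUpper} (hx : ¬ E.Term x) :
    (∃ y, E.Step k x y ∨ E.Step k y x) ∨ (k = 1 ∧ ∃ i, E.At i 0 x) := by
  obtain ⟨y, i, j, h1, h2⟩ := not_term_iff.1 hx
  by_cases hj : j % 2 = k
  · exact Or.inl ⟨y, Or.inl ⟨i, j, h1, h2, hj⟩⟩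
  · obtain _ | j := j
    · exact Or.inr ⟨by omega, i, h1⟩
    · obtain ⟨z, hz⟩ := h1.of_le (Nat.le_succ j)
      exact Or.inl ⟨z, Or.inr ⟨i, j, hz, h1, by omega⟩⟩

/-- A nonterminal upper point joins an arriving and a departing arc of different types. The arriving
one is a base arc exactly at the first upper point of a curve, where no under arc is available. -/
theorem exists_joins_of_not_term {k : ℕ} (hk : k < 2) {x : Fin E.numUpper} (hx : ¬ E.Term x) :
    (∃ (γ : E.Arc) (l h : ℕ), γ.Spans k l h ∧ γ.Incident (Sum.inr x)) ∨
      (k = 1 ∧ ∃ γ : E.Arc, γ.IsBase ∧ γ.tgt = Sum.inr x) := by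
  rcases exists_step_of_not_term hk hx with ⟨y, h | h⟩ | ⟨hk, i, hi⟩
  · obtain ⟨γ, hγ⟩ := h.exists_joins
    obtain ⟨l, h, hs⟩ := hγ.exists_spans
    exact Or.inl ⟨γ, l, h, hs, Or.inl hγ.src_eq.symm⟩
  · obtain ⟨γ, hγ⟩ := h.exists_joins
    obtain ⟨l, h, hs⟩ := hγ.exists_spans
    exact Or.inl ⟨γ, l, h, hs, Or.inr hγ.tgt_eq.symm⟩
  · obtain ⟨hlt, hx⟩ := List.getElem?_eq_some_iff.1 hi
    refine Or.inr ⟨hk, ⟨i, ⟨0, hlt⟩⟩, rfl, ?_⟩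
    simp [Arc.tgt, path, hx]

theorem isPlanar_over (hcross : ∀ α β : E.Arc, α.IsOver → β.IsOver → ¬ α.Cross β)
    (hadj : ∀ p q, E.Next p q → ¬ Adj p q) : IsPlanar {α : E.Arc | α.IsOver} 0 where
  exists_spans α hα := by
    obtain ⟨p, q, h⟩ := Arc.isOver_iff.1 hα
    exact h.exists_spans
  not_spans_succ α _ l hs := by
    have h := hs.adjacent_iff.2 rfl
    obtain ⟨p, q, hj, -⟩ := hs
    exact hadj p q hj.step.next (hj.adjacent_iff.1 h)
  not_cross α hα β hβ := hcross α β hα hβ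
  exists_incident α _ x _ hx := by
    rcases exists_joins_of_not_term (k := 0) (by omega) hx with ⟨γ, l, h, hs, hγ⟩ | ⟨h, -⟩
    · exact ⟨γ, hs.isOver_iff.2 rfl, hγ⟩
    · exact absurd h (by omega)

theorem Arc.exists_tgt_eq (α : E.Arc) : ∃ q, α.tgt = Sum.inr q := by
  simp [Arc.tgt, path]

theorem Arc.cross_base_iff {α β : E.Arc} (hα : α.IsUnder) (hβ : β.IsBase) :
    α.Cross β ↔ α.EnclosesPoint β.tgt := by
  unfold Arc.IsUnder at hα
  unfold Arc.IsBase at hβ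
  unfold Arc.Cross
  rw [hα, hβ]

/-- An under arc crossing `γ` does not cross `α`, so `α` encloses it and thus a crossing pair, which
freeness forbids. A base arc crossing `γ` would cross `α`. -/
theorem Arc.IsFreeUnder.of_enclosesArc {α γ : E.Arc} (hα : α.IsFreeUnder) (hγ : γ.IsUnder)
    (h : α.EnclosesArc γ) : γ.IsFreeUnder := by
  obtain ⟨hα, hcross, hpair⟩ := hα
  obtain ⟨k, a, b, hs⟩ := Arc.exists_spans (Or.inr hα)
  obtain ⟨k', a', b', hs'⟩ := Arc.exists_spans (Or.inr hγ)
  obtain rfl := hs.isUnder_iff.1 hα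
  obtain rfl := hs'.isUnder_iff.1 hγ
  have hencl := (hs.enclosesArc_iff hs').1 h
  refine ⟨hγ, ?_, ?_⟩
  · rintro β (hβ | hβ) hγβ
    · have h1 := hcross β (Or.inl hβ)
      obtain ⟨k'', c, d, hsβ⟩ := Arc.exists_spans (Or.inr hβ)
      obtain rfl := hsβ.isUnder_iff.1 hβ
      refine hpair ⟨γ, β, hγ, hβ, hγβ, h, ?_⟩
      rw [hs.cross_iff hsβ] at h1
      rw [hs'.cross_iff hsβ] at hγβ
      rw [hs.enclosesArc_iff hsβ]
      unfold Xor at h1 hγβ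
      omega
    · have h1 := hcross β (Or.inr hβ)
      rw [Arc.cross_base_iff hα hβ] at h1
      rw [Arc.cross_base_iff hγ hβ] at hγβ
      obtain ⟨q, hq⟩ := β.exists_tgt_eq
      rw [hq, hs.enclosesPoint_iff] at h1
      rw [hq, hs'.enclosesPoint_iff] at hγβ
      omega
  · rintro ⟨β, δ, hβ, hδ, hβδ, h1, h2⟩
    obtain ⟨_, c, d, hsβ⟩ := Arc.exists_spans (Or.inr hβ)
    obtain ⟨_, c', d', hsδ⟩ := Arc.exists_spans (Or.inr hδ)
    rw [hs'.enclosesArc_iff hsβ] at h1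
    rw [hs'.enclosesArc_iff hsδ] at h2
    exact hpair ⟨β, δ, hβ, hδ, hβδ, (hs.enclosesArc_iff hsβ).2 (by omega),
      (hs.enclosesArc_iff hsδ).2 (by omega)⟩

/-- An enclosed nonterminal point is not the end of a base arc, which would be crossed. The under
arc through it is not crossed either, so it is enclosed and inherits freeness. -/
theorem isPlanar_freeUnder (hadj : ∀ p q, E.Next p q → ¬ Adj p q) :
    IsPlanar {α : E.Arc | α.IsFreeUnder} 1 where
  exists_spans α hα := by
    obtain ⟨p, q, h⟩ := Arc.isUnder_iff.1 hα.1
    exact h.exists_spans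
  not_spans_succ α _ l hs := by
    have h := hs.adjacent_iff.2 rfl
    obtain ⟨p, q, hj, -⟩ := hs
    exact hadj p q hj.step.next (hj.adjacent_iff.1 h)
  not_cross α hα β hβ := hα.2.1 β (Or.inl hβ.1)
  exists_incident α hα x hαx hx := by
    rcases exists_joins_of_not_term (k := 1) (by omega) hx with ⟨γ, l, h, hs, hγ⟩ | ⟨-, γ, hγ, hx⟩
    · have hγu := hs.isUnder_iff.2 rfl
      refine ⟨γ, hα.of_enclosesArc hγu ?_, hγ⟩
      have h1 := hα.2.1 γ (Or.inl hγu)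
      obtain ⟨p, q, hj⟩ := Arc.isUnder_iff.1 hα.1
      obtain ⟨a, b, hs'⟩ := hj.exists_spans
      rw [hs'.cross_iff hs] at h1
      rw [hs'.enclosesPoint_iff] at hαx
      rw [hs.incident_iff] at hγ
      rw [hs'.enclosesArc_iff hs]
      unfold Xor at h1
      omega
    · have h1 := hα.2.1 γ (Or.inr hγ)
      rw [Arc.cross_base_iff hα.1 hγ, hx] at h1
      exact absurd hαx h1

end CurveSystem

/-! ### Counting base arcs by their curves -/

namespace CVCD

variable {n : ℕ}

theorem ncard_freeCondensedBaseArcs_le (D : CVCD n) : D.freeCondensedBaseArcs.ncard ≤ n := by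
  classical
  have hsub : D.freeCondensedBaseArcs ⊆
      Set.range fun i : Fin n => {β : D.underlying.Arc |
        Arc.Parallel ⟨i, ⟨0, List.length_pos_iff.2 (D.underlying.curve_ne_nil i)⟩⟩ β} := by
    rintro A ⟨⟨α, rfl⟩, hA⟩
    have h1 : α.IsBase := (hA α Relation.ReflTransGen.refl).1
    unfold Arc.IsBase Arc.kind at h1
    have h2 : α.2.val = 0 := by
      split_ifs at h1 with h
      exact h
    refine ⟨α.1, ?_⟩
    have h3 : (⟨α.1, ⟨0, List.length_pos_iff.2 (D.underlying.curve_ne_nil α.1)⟩⟩ :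
        D.underlying.Arc) = α := Arc.ext_of rfl h2.symm
    dsimp only
    rw [h3]
  calc D.freeCondensedBaseArcs.ncard ≤ _ := Set.ncard_le_ncard hsub (Set.toFinite _)
    _ ≤ n := by
      rw [← Set.image_univ]
      refine (Set.ncard_image_le (Set.toFinite _)).trans ?_
      simp [Set.ncard_univ]

end CVCD

theorem mainTheorem3 (n : ℕ) :
    (∀ D : CVCD n, D.Simplified ↔
      ¬ ∃ D' : CVCD n, D.SimplifyingCondensedT D' ∨ D.SimplifyingCondensedB D') ∧
    (∀ D₁ D₂ : CVCD n, D₁.Simplified → D₂.Simplified → D₁.Related D₂ → D₁ = D₂) ∧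
    (1 ≤ n → ∀ D : CVCD n, D.Simplified →
      D.condensedOverArcs.ncard ≤ 2 * n - 1 ∧
      D.freeCondensedUnderArcs.ncard ≤ 2 * n - 1 ∧
      D.freeCondensedBaseArcs.ncard ≤ n) := by
  refine ⟨CVCD.simplified_iff_no_move, fun D₁ D₂ => CVCD.eq_of_related, fun _ D hD => ?_⟩
  have hadj := VCD.simplified_iff.1 hD
  exact ⟨(isPlanar_over D.underlying.over_not_cross hadj).ncard_condensedArcs_le,
    (isPlanar_freeUnder hadj).ncard_condensedArcs_le, D.ncard_freeCondensedBaseArcs_le⟩
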